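/- For complex $a,q$ with $|q|<1$ let $(a;q)_\infty=\prod_{n\ge 0}(1-aq^n)$ and $(a_1,\dots,a_m;q)_\infty=(a_1;q)_\infty\cdots(a_m;q)_\infty$. Let $g_1(n)$, $n\ge 0$, be the coefficients of the power series expansion $$(-q,-q^4;q^5)_\infty^2\,(q^4,q^6;q^{10})_\infty=\sum_{n=0}^\infty g_1(n)q^n\qquad(|q|<1).$$ Then for all complex $q$ with $|q|<1$ $$(-q,-q^4;q^5)_\infty^2\,(q^4,q^6;q^{10})_\infty=G_0(q^5)+q\,G_1(q^5)+q^2G_2(q^5)+q^4G_4(q^5),$$ where $$G_0(q)=\sum_{n=0}^\infty g_1(5n)q^n=\frac{1}{(q,q^4;q^5)_\infty^2\,(q^2,q^8;q^{10})_\infty},$$ $$G_1(q)=\sum_{n=0}^\infty g_1(5n+1)q^n=\frac{2}{(q,q^2,q^3,q^4;q^5)_\infty\,(q^2,q^8;q^{10})_\infty},$$ $$G_2(q)=\sum_{n=0}^\infty g_1(5n+2)q^n=\frac{1}{(q,q^4;q^5)_\infty^2\,(q^4,q^6;q^{10})_\infty},$$ $$G_4(q)=\sum_{n=0}^\infty g_1(5n+4)q^n=\frac{1}{(q^2,q^3;q^5)_\infty^2\,(q^4,q^6;q^{10})_\infty}.$$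 In particular $g_1(5n+3)=0$ for all $n\ge 0$. -/

import Mathlib

/-- The infinite `q`-shifted factorial `(a; q)_∞ = ∏_{n ≥ 0} (1 - a q ^ n)`, used for `‖q‖ < 1`. -/
noncomputable def qPoch (a q : ℂ) : ℂ := ∏' n : ℕ, (1 - a * q ^ n)

/-- The multiple symbol `(a₁, …, aₘ; q)_∞ = (a₁; q)_∞ ⋯ (aₘ; q)_∞`. -/
noncomputable def qPochList (as : List ℂ) (q : ℂ) : ℂ := (as.map fun a => qPoch a q).prod

/-- The function `(-q, -q⁴; q⁵)_∞² (q⁴, q⁶; q¹⁰)_∞` of `q` in the open unit disc. -/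
noncomputable def genG1 (q : ℂ) : ℂ :=
  qPochList [-q, -q ^ 4] (q ^ 5) ^ 2 * qPochList [q ^ 4, q ^ 6] (q ^ 10)

/-- `g1 n` is the coefficient of `q ^ n` in the power series expansion of `genG1` about `q = 0`. -/
noncomputable def g1 (n : ℕ) : ℂ := iteratedDeriv n genG1 0 / (n.factorial : ℂ)

/-- `G1comp r q = ∑_{n ≥ 0} g1 (5n + r) q ^ n`, the component of residue `r` modulo `5`. -/
noncomputable def G1comp (r : ℕ) (q : ℂ) : ℂ := ∑' n : ℕ, g1 (5 * n + r) * q ^ n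

open Filter Topology Finset

/-! By the Jacobi triple product, `qTheta q ε k N` is Ramanujan's f(εq^k, εq^(N-k)), where ε = ±1.
Multiplying the generating function by (q⁵;q⁵)²(q¹⁰;q¹⁰), which depends on q⁵ only, turns it into
f(q,q⁴)² f(-q⁴,-q⁶), so it suffices to dissect this theta product.

The form m² + n² on ℤ² restricts to 2(s² + t²) on the sublattice spanned by (1,1), (1,-1), and to
5(s² + t²) on the one spanned by (1,2), (2,-1). Hence a product of two theta series splits, coset by
coset, into products of two theta series of higher base. The index-two splitting gives f(q,q⁴)² =
f(q²,q⁸)φ(q⁵) + 2q f(q³,q⁷)ψ(q¹⁰). The index-five splitting of f(q²,q⁸)f(-q⁴,-q⁶) and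
f(q³,q⁷)f(-q⁴,-q⁶) then yields powers of q times functions of q⁵. The residue 3 term carries the
factor f(-1,·) = 0, which is why that class is empty.

The remaining coefficients, with Q = q⁵, are three differences of theta products, evaluated by
`phi_mul_sub_psi_mul`, `psi_mul_sub_phi_mul` and `psi_mul_phi_sub`. The first two are Weierstrass
three-term relations rewritten through products; the third follows from them algebraically. This
gives `theta_five_dissection`, and dividing gives `genG1_eq_dissection`. All functions involved are
holomorphic in the disc, so uniqueness of Taylor coefficients converts the functional identity into
one for each `g1 (5 * n + r)`. -/

/-! ### Infinite products: convergence, non-vanishing, splitting of the base, holomorphy -/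

theorem summable_norm_qPoch_factor (a : ℂ) {q : ℂ} (hq : ‖q‖ < 1) :
    Summable fun n : ℕ => ‖-(a * q ^ n)‖ := by
  simpa using (summable_geometric_of_lt_one (norm_nonneg q) hq).mul_left ‖a‖

theorem multipliable_qPoch (a : ℂ) {q : ℂ} (hq : ‖q‖ < 1) :
    Multipliable fun n : ℕ => 1 - a * q ^ n := by
  simpa [sub_eq_add_neg] using
    multipliable_one_add_of_summable (summable_norm_qPoch_factor a hq)

theorem tendsto_qPoch (a : ℂ) {q : ℂ} (hq : ‖q‖ < 1) :
    Tendsto (fun N => ∏ n ∈ range N, (1 - a * q ^ n)) atTop (𝓝 (qPoch a q)) :=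
  (multipliable_qPoch a hq).hasProd.tendsto_prod_nat

theorem qPoch_ne_zero {a q : ℂ} (hq : ‖q‖ < 1) (ha : ‖a‖ < 1) : qPoch a q ≠ 0 := by
  have := tprod_one_add_ne_zero_of_summable (f := fun n : ℕ => -(a * q ^ n)) (fun n h => ?_)
    (summable_norm_qPoch_factor a hq)
  · simpa [qPoch, sub_eq_add_neg] using this
  · have h1 : a * q ^ n = 1 := by linear_combination -h
    have h2 : ‖a * q ^ n‖ < 1 := by
      rw [norm_mul, norm_pow]
      exact mul_lt_one_of_nonneg_of_lt_one_left (norm_nonneg _) ha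
        (pow_le_one₀ (norm_nonneg _) hq.le)
    rw [h1, norm_one] at h2
    exact lt_irrefl _ h2

theorem qPoch_mul_neg (a : ℂ) {q : ℂ} (hq : ‖q‖ < 1) :
    qPoch a q * qPoch (-a) q = qPoch (a ^ 2) (q ^ 2) := by
  rw [qPoch, qPoch, qPoch, ← (multipliable_qPoch a hq).tprod_mul (multipliable_qPoch (-a) hq)]
  refine tprod_congr fun n => ?_
  ring

theorem qPoch_eq_one_sub_mul (a : ℂ) {q : ℂ} (hq : ‖q‖ < 1) :
    qPoch a q = (1 - a) * qPoch (a * q) q := by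
  refine tendsto_nhds_unique ((tendsto_qPoch a hq).comp (tendsto_add_atTop_nat 1)) ?_
  refine ((tendsto_qPoch (a * q) hq).const_mul (1 - a)).congr fun N => ?_
  simp only [Function.comp, prod_range_succ', pow_zero, mul_one]
  rw [mul_comm]
  congr 1
  refine prod_congr rfl fun n _ => ?_
  ring

/-- Sort the factors by the residue of their index modulo `k`, comparing partial products of length
`k * N`. -/
theorem qPoch_eq_prod_qPoch_pow (a : ℂ) {q : ℂ} (hq : ‖q‖ < 1) {k : ℕ} (hk : k ≠ 0) :
    qPoch a q = ∏ i ∈ range k, qPoch (a * q ^ i) (q ^ k) := by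
  have hqk : ‖q ^ k‖ < 1 := by simpa using pow_lt_one₀ (norm_nonneg q) hq hk
  have h1 : Tendsto (fun N : ℕ => k * N) atTop atTop :=
    tendsto_id.const_mul_atTop' (Nat.pos_of_ne_zero hk)
  refine tendsto_nhds_unique ((tendsto_qPoch a hq).comp h1) ?_
  refine (tendsto_finsetProd (range k)
    fun i _ => tendsto_qPoch (a * q ^ i) hqk).congr fun N => ?_
  rw [Finset.prod_comm]
  simp only [Function.comp]
  induction N with
  | zero => simp
  | succ N ih =>
    rw [prod_range_succ, ih, Nat.mul_succ, prod_range_add]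
    congr 1
    refine prod_congr rfl fun i _ => ?_
    ring

theorem differentiableOn_qPoch {a : ℂ → ℂ} (ha : Differentiable ℂ a) {k : ℕ} (hk : k ≠ 0) :
    DifferentiableOn ℂ (fun q => qPoch (a q) (q ^ k)) (Metric.ball (0 : ℂ) 1) := by
  have h : HasProdLocallyUniformlyOn (fun (n : ℕ) q => 1 + -(a q * (q ^ k) ^ n))
      (fun q => ∏' n : ℕ, (1 + -(a q * (q ^ k) ^ n))) (Metric.ball (0 : ℂ) 1) := by
    apply hasProdLocallyUniformlyOn_of_forall_compact Metric.isOpen_ball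
    intro K hK hcK
    rcases K.eq_empty_or_nonempty with hN | hN
    · simpa [hasProdUniformlyOn_iff_tendstoUniformlyOn, hN] using tendstoUniformlyOn_empty
    -- On the compact set, `q₀` and `q₁` maximise ‖q‖ and ‖a q‖; they give a geometric majorant
    -- independent of the point.
    · obtain ⟨q₀, hq₀, _, HB⟩ := hcK.exists_sSup_image_eq_and_ge hN
        (show ContinuousOn (fun q : ℂ ↦ ‖q‖) K by fun_prop)
      obtain ⟨q₁, hq₁, _, HA⟩ := hcK.exists_sSup_image_eq_and_ge hN
        (show ContinuousOn (fun q : ℂ ↦ ‖a q‖) K from ha.continuous.norm.continuousOn)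
      have hlt : ‖q₀‖ ^ k < 1 := pow_lt_one₀ (norm_nonneg _)
        (by simpa [Metric.mem_ball, dist_zero_right] using hK hq₀) hk
      refine ((summable_geometric_of_lt_one (by positivity) hlt).mul_left
        ‖a q₁‖).hasProdUniformlyOn_nat_one_add hcK (.of_forall fun n x hx ↦ ?_)
        (fun _ ↦ (Continuous.continuousOn ?_))
      · rw [norm_neg, norm_mul, norm_pow, norm_pow]
        gcongr
        · exact HA x hx
        · exact HB x hx
      · have := ha.continuous
        fun_prop
  refine DifferentiableOn.congr (h.differentiableOn (.of_forall fun s ↦ ?_) Metric.isOpen_ball)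
    fun q _ => by simp only [qPoch, sub_eq_add_neg]
  simpa [Finset.prod_fn] using
      DifferentiableOn.finsetProd (fun _ _ ↦ Differentiable.differentiableOn (by fun_prop))

/-! ### Theta series and their convergence -/

/-- The triangular number `n (n - 1) / 2` of an integer. -/
def tri (n : ℤ) : ℤ := n * (n - 1) / 2

theorem two_mul_tri (n : ℤ) : 2 * tri n = n * (n - 1) :=
  Int.mul_ediv_cancel' (by
    have := Int.even_mul_pred_self n
    exact this.two_dvd)

/-- The theta series `∑ z ^ n p ^ (n (n - 1) / 2)`, that is `f (z, p / z)` of Ramanujan. -/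
noncomputable def theta (z p : ℂ) : ℂ := ∑' n : ℤ, z ^ n * p ^ tri n

theorem tri_add_one (n : ℤ) : tri (n + 1) = tri n + n := by
  have h1 := two_mul_tri (n + 1)
  have h2 := two_mul_tri n
  linarith

theorem tri_neg (n : ℤ) : tri (-n) = tri n + n := by
  have h1 := two_mul_tri (-n)
  have h2 := two_mul_tri n
  linarith

theorem summable_norm_theta_nat {z p : ℂ} (hz : z ≠ 0) (hp : p ≠ 0) (hp1 : ‖p‖ < 1) :
    Summable fun n : ℕ => ‖z ^ (n : ℤ) * p ^ tri n‖ := by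
  refine summable_of_ratio_test_tendsto_lt_one (l := 0) zero_lt_one
    (.of_forall fun n => norm_ne_zero_iff.2
      (mul_ne_zero (zpow_ne_zero _ hz) (zpow_ne_zero _ hp))) ?_
  have h : Tendsto (fun n : ℕ => ‖z‖ * ‖p‖ ^ n) atTop (𝓝 0) := by
    simpa using (tendsto_pow_atTop_nhds_zero_of_lt_one (norm_nonneg p) hp1).const_mul ‖z‖
  refine h.congr fun n => ?_
  have hz' : ‖z‖ ≠ 0 := norm_ne_zero_iff.2 hz
  have hp' : ‖p‖ ≠ 0 := norm_ne_zero_iff.2 hp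
  push_cast
  rw [tri_add_one, zpow_add₀ hp, zpow_add₀ hz]
  simp only [norm_norm, norm_mul, norm_zpow, norm_pow, zpow_natCast, zpow_one]
  have h1 : ‖p‖ ^ tri n ≠ 0 := zpow_ne_zero _ hp'
  field_simp

theorem summable_norm_theta {z p : ℂ} (hz : z ≠ 0) (hp : p ≠ 0) (hp1 : ‖p‖ < 1) :
    Summable fun n : ℤ => ‖z ^ n * p ^ tri n‖ := by
  refine Summable.of_nat_of_neg (summable_norm_theta_nat hz hp hp1) ?_
  -- Reversing the sign of the index replaces z by p / z, so the negative half is again a one-sided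
  -- series.
  refine (summable_norm_theta_nat (div_ne_zero hp hz) hp hp1).congr fun n => ?_
  rw [tri_neg, zpow_add₀ hp, div_zpow, zpow_neg]
  congr 1
  ring

/-! ### The q-binomial theorem and the Jacobi triple product -/

/-- The Gaussian binomial coefficient, defined by the `q`-Pascal recurrence. -/
def gaussBinom (p : ℂ) : ℕ → ℕ → ℂ
  | _, 0 => 1
  | 0, _ + 1 => 0
  | M + 1, j + 1 => gaussBinom p M (j + 1) + p ^ (M - j) * gaussBinom p M j

theorem gaussBinom_zero_right (p : ℂ) (M : ℕ) : gaussBinom p M 0 = 1 := by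
  cases M <;> rfl

theorem gaussBinom_succ_succ (p : ℂ) (M j : ℕ) :
    gaussBinom p (M + 1) (j + 1) = gaussBinom p M (j + 1) + p ^ (M - j) * gaussBinom p M j := rfl

theorem gaussBinom_eq_zero_of_lt (p : ℂ) {M j : ℕ} (h : M < j) : gaussBinom p M j = 0 := by
  induction M generalizing j with
  | zero => obtain ⟨k, rfl⟩ := Nat.exists_eq_succ_of_ne_zero h.ne'; rfl
  | succ M ih =>
    obtain ⟨k, rfl⟩ := Nat.exists_eq_succ_of_ne_zero (Nat.ne_of_gt (Nat.zero_lt_of_lt h))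
    rw [Nat.succ_eq_add_one, gaussBinom_succ_succ, ih (by omega), ih (by omega)]
    simp

/-- The finite `q`-factorial `(p; p)_n`. -/
def qFact (p : ℂ) (n : ℕ) : ℂ := ∏ i ∈ range n, (1 - p * p ^ i)

theorem qFact_succ (p : ℂ) (n : ℕ) : qFact p (n + 1) = qFact p n * (1 - p * p ^ n) :=
  prod_range_succ _ _

theorem gaussBinom_mul_qFact (p : ℂ) (j k : ℕ) :
    gaussBinom p (j + k) j * qFact p j * qFact p k = qFact p (j + k) := by
  induction j generalizing k with
  | zero => simp [gaussBinom_zero_right, qFact]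
  | succ j ihj =>
    induction k with
    | zero =>
      have h := ihj 0
      rw [show j + 1 + 0 = (j + 0) + 1 by ring, gaussBinom_succ_succ,
        gaussBinom_eq_zero_of_lt p (by omega)]
      simp only [add_zero, Nat.sub_self, pow_zero, zero_add, one_mul, qFact_succ] at *
      linear_combination (1 - p * p ^ j) * h
    | succ k ihk =>
      have h := ihj (k + 1)
      rw [show j + 1 + (k + 1) = (j + (k + 1)) + 1 by ring, gaussBinom_succ_succ,
        show j + (k + 1) - j = k + 1 by omega, qFact_succ p (j + (k + 1))]
      rw [show j + 1 + k = j + (k + 1) by ring] at ihk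
      rw [qFact_succ p k] at h ⊢
      rw [qFact_succ p j] at ihk ⊢
      linear_combination (1 - p * p ^ k) * ihk + p ^ (k + 1) * (1 - p * p ^ j) * h

/-- The `q`-binomial theorem. -/
theorem prod_one_add_mul_pow (p x : ℂ) (M : ℕ) :
    ∏ k ∈ range M, (1 + x * p ^ k) =
      ∑ j ∈ range (M + 1), gaussBinom p M j * p ^ (j.choose 2) * x ^ j := by
  induction M with
  | zero => simp [gaussBinom_zero_right]
  | succ M ih =>
    have h1 : ∑ j ∈ range (M + 1), gaussBinom p M j * p ^ j.choose 2 * x ^ j =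
        ∑ j ∈ range (M + 1), gaussBinom p M (j + 1) * p ^ (j + 1).choose 2 * x ^ (j + 1) + 1 := by
      rw [sum_range_succ', sum_range_succ, gaussBinom_eq_zero_of_lt p (Nat.lt_succ_self M)]
      simp [gaussBinom_zero_right]
    have h2 : (∑ j ∈ range (M + 1), gaussBinom p M j * p ^ j.choose 2 * x ^ j) * (x * p ^ M) =
        ∑ j ∈ range (M + 1),
          p ^ (M - j) * gaussBinom p M j * p ^ (j + 1).choose 2 * x ^ (j + 1) := by
      rw [sum_mul]
      refine sum_congr rfl fun j hj => ?_
      have hj' : j ≤ M := Nat.lt_succ_iff.1 (mem_range.1 hj)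
      obtain ⟨k, rfl⟩ := Nat.exists_eq_add_of_le hj'
      rw [Nat.add_sub_cancel_left, Nat.choose_succ_succ' j 1, Nat.choose_one_right]
      ring
    rw [prod_range_succ, ih, mul_add, mul_one, h2, h1, sum_range_succ' _ (M + 1)]
    simp only [gaussBinom_succ_succ, gaussBinom_zero_right, Nat.choose_zero_succ, pow_zero,
      mul_one, add_mul, sum_add_distrib]
    ring

theorem cast_choose_two_eq_tri (j : ℕ) : ((j.choose 2 : ℕ) : ℤ) = tri j := by
  induction j with
  | zero => rfl
  | succ j ih =>
    rw [Nat.choose_succ_succ' j 1, Nat.choose_one_right]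
    push_cast
    rw [tri_add_one, ih]; ring

theorem finite_jacobi_triple_product {z p : ℂ} (hz : z ≠ 0) (hp : p ≠ 0) (N : ℕ) :
    (∏ k ∈ range N, (1 + z * p ^ k)) * ∏ k ∈ range N, (1 + p / z * p ^ k) =
      ∑ n ∈ Icc (-N : ℤ) N, gaussBinom p (2 * N) (n + N).toNat * (z ^ n * p ^ tri n) := by
  -- The shift by p^(-N) centres the product of 2N factors. Pulling z p^(-(k+1)) out of each of the
  -- first N factors leaves the factors in p / z.
  have h := prod_one_add_mul_pow p (z * p ^ (-N : ℤ)) (2 * N)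
  have hl : ∏ k ∈ range (2 * N), (1 + z * p ^ (-N : ℤ) * p ^ k) =
      (z ^ N * p ^ (-tri (N + 1))) *
        ((∏ k ∈ range N, (1 + z * p ^ k)) * ∏ k ∈ range N, (1 + p / z * p ^ k)) := by
    rw [two_mul, prod_range_add, mul_comm (∏ k ∈ range N, (1 + z * p ^ k)), ← mul_assoc]
    congr 1
    · rw [← prod_range_reflect]
      have : ∀ n : ℕ, z ^ n * p ^ (-tri (n + 1)) = ∏ k ∈ range n, (z * p ^ (-(k + 1) : ℤ)) := by
        intro n
        induction n with
        | zero => simp [tri]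
        | succ n ih =>
          rw [prod_range_succ, ← ih]
          push_cast
          rw [tri_add_one (n + 1), neg_add, zpow_add₀ hp, pow_succ]
          ring
      rw [this, ← prod_mul_distrib]
      refine prod_congr rfl fun k hk => ?_
      have hk' := mem_range.1 hk
      have e1 : p ^ (-(k + 1) : ℤ) * (p * p ^ k) = 1 := by
        rw [← pow_succ', ← zpow_natCast, ← zpow_add₀ hp]; simp
      have e2 : p ^ (-N : ℤ) * p ^ (N - 1 - k) = p ^ (-(k + 1) : ℤ) := by
        rw [← zpow_natCast, ← zpow_add₀ hp]; congr 1; omega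
      rw [mul_assoc, e2]
      field_simp
      linear_combination -e1
    · refine prod_congr rfl fun k _ => ?_
      have e : p ^ (-N : ℤ) * p ^ N = 1 := by
        rw [← zpow_natCast, ← zpow_add₀ hp]; simp
      rw [pow_add]
      linear_combination z * p ^ k * e
  rw [hl] at h
  have hc : z ^ N * p ^ (-tri (N + 1)) ≠ 0 := mul_ne_zero (pow_ne_zero _ hz) (zpow_ne_zero _ hp)
  refine mul_left_cancel₀ hc (h.trans ?_)
  rw [mul_sum]
  refine sum_bij' (fun j _ => (j : ℤ) - N) (fun n _ => (n + N).toNat) ?_ ?_ ?_ ?_ ?_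
  · intro j hj; simp only [mem_range, mem_Icc] at *; omega
  · intro n hn; simp only [mem_range, mem_Icc] at *; omega
  · intro j hj; simp
  · intro n hn; simp only [mem_Icc] at *; omega
  · intro j hj
    have e1 : ((j : ℤ) - N + N).toNat = j := by simp
    rw [e1, ← zpow_natCast p (j.choose 2), cast_choose_two_eq_tri, mul_pow, ← zpow_natCast (p ^ _),
      ← zpow_mul, zpow_sub₀ hz]
    have e2 : p ^ tri j * p ^ (-N * j : ℤ) = p ^ (-tri (N + 1)) * p ^ tri ((j : ℤ) - N) := by
      rw [← zpow_add₀ hp, ← zpow_add₀ hp]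
      congr 1
      have h1 := two_mul_tri (j - N)
      have h2 := two_mul_tri j
      have h3 := two_mul_tri (N + 1)
      linarith
    simp only [zpow_natCast]
    field_simp
    linear_combination gaussBinom p (2 * N) j * e2

theorem tendsto_qFact {p : ℂ} (hp1 : ‖p‖ < 1) :
    Tendsto (qFact p) atTop (𝓝 (qPoch p p)) := tendsto_qPoch p hp1

theorem qFact_ne_zero {p : ℂ} (hp1 : ‖p‖ < 1) (n : ℕ) : qFact p n ≠ 0 := by
  refine prod_ne_zero_iff.2 fun i _ h => ?_
  have h1 : ‖p ^ (i + 1)‖ < 1 := by simpa using pow_lt_one₀ (norm_nonneg p) hp1 i.succ_ne_zero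
  rw [pow_succ', show p * p ^ i = 1 by linear_combination -h, norm_one] at h1
  exact lt_irrefl _ h1

theorem gaussBinom_eq_div {p : ℂ} (hp1 : ‖p‖ < 1) (j k : ℕ) :
    gaussBinom p (j + k) j = qFact p (j + k) * ((qFact p j)⁻¹ * (qFact p k)⁻¹) := by
  have h := gaussBinom_mul_qFact p j k
  have h1 := qFact_ne_zero hp1 j
  have h2 := qFact_ne_zero hp1 k
  field_simp
  linear_combination h

/-- Since (p;p)_n tends to a nonzero limit, it and its inverse are bounded. The uniform bound
supplies the majorant for passing to the limit in the finite triple product. -/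
theorem exists_bound_gaussBinom {p : ℂ} (hp1 : ‖p‖ < 1) :
    ∃ C, ∀ M j, ‖gaussBinom p M j‖ ≤ C := by
  have hne := qPoch_ne_zero hp1 hp1
  obtain ⟨A, hA⟩ := (tendsto_qFact hp1).norm.bddAbove_range
  obtain ⟨B, hB⟩ := ((tendsto_qFact hp1).inv₀ hne).norm.bddAbove_range
  have hAle : ∀ n, ‖qFact p n‖ ≤ A := fun n => hA ⟨n, rfl⟩
  have hBle : ∀ n, ‖(qFact p n)⁻¹‖ ≤ B := fun n => hB ⟨n, rfl⟩
  have hA0 : 0 ≤ A := (norm_nonneg _).trans (hAle 0)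
  have hB0 : 0 ≤ B := (norm_nonneg _).trans (hBle 0)
  refine ⟨A * (B * B), fun M j => ?_⟩
  rcases lt_or_ge M j with h | h
  · rw [gaussBinom_eq_zero_of_lt p h, norm_zero]; positivity
  · obtain ⟨k, rfl⟩ := Nat.exists_eq_add_of_le h
    rw [gaussBinom_eq_div hp1, norm_mul, norm_mul]
    gcongr
    · exact hAle _
    · exact hBle _
    · exact hBle _

/-- The Jacobi triple product identity. -/
theorem theta_eq_prod {z p : ℂ} (hz : z ≠ 0) (hp : p ≠ 0) (hp1 : ‖p‖ < 1) :
    theta z p = qPoch (-z) p * qPoch (-(p / z)) p * qPoch p p := by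
  have hne := qPoch_ne_zero hp1 hp1
  obtain ⟨C, hC⟩ := exists_bound_gaussBinom hp1
  let F : ℕ → ℤ → ℂ := fun N n =>
    if n ∈ Icc (-N : ℤ) N then gaussBinom p (2 * N) (n + N).toNat * (z ^ n * p ^ tri n) else 0
  have hlim : Tendsto (fun N => ∑' n, F N n) atTop
      (𝓝 (∑' n : ℤ, (qPoch p p)⁻¹ * (z ^ n * p ^ tri n))) := by
    refine tendsto_tsum_of_dominated_convergence
      ((summable_norm_theta hz hp hp1).mul_left C) (fun n => ?_) (.of_forall fun N n => ?_)
    · have h1 : Tendsto (fun N : ℕ => (n + N).toNat) atTop atTop :=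
        tendsto_atTop_atTop.2 fun b => ⟨b + n.natAbs, fun a ha => by omega⟩
      have h2 : Tendsto (fun N : ℕ => (-n + N).toNat) atTop atTop :=
        tendsto_atTop_atTop.2 fun b => ⟨b + n.natAbs, fun a ha => by omega⟩
      have h3 : Tendsto (fun N : ℕ => 2 * N) atTop atTop :=
        tendsto_id.const_mul_atTop' two_pos
      have h4 := ((tendsto_qFact hp1).comp h3).mul
        ((((tendsto_qFact hp1).inv₀ hne).comp h1).mul (((tendsto_qFact hp1).inv₀ hne).comp h2))
      rw [mul_inv_cancel_left₀ hne] at h4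
      refine (h4.mul_const _).congr' ?_
      filter_upwards [eventually_ge_atTop n.natAbs] with N hN
      have hmem : n ∈ Icc (-N : ℤ) N := by rw [mem_Icc]; omega
      have e : 2 * N = (n + N).toNat + (-n + N).toNat := by omega
      simp only [F, if_pos hmem, Function.comp]
      rw [e, gaussBinom_eq_div hp1]
    · simp only [F]
      split_ifs
      · rw [norm_mul]
        gcongr
        exact hC _ _
      · rw [norm_zero]
        exact mul_nonneg ((norm_nonneg _).trans (hC 0 0)) (norm_nonneg _)
  have hprod := (tendsto_qPoch (-z) hp1).mul (tendsto_qPoch (-(p / z)) hp1)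
  have heq : ∀ N : ℕ, ∑' n, F N n =
      (∏ k ∈ range N, (1 - -z * p ^ k)) * ∏ k ∈ range N, (1 - -(p / z) * p ^ k) := by
    intro N
    rw [tsum_eq_sum (s := Icc (-N : ℤ) N) fun n hn => if_neg hn]
    simp only [neg_mul, sub_neg_eq_add]
    rw [finite_jacobi_triple_product hz hp]
    exact sum_congr rfl fun n hn => if_pos hn
  have := tendsto_nhds_unique (hprod.congr fun N => (heq N).symm) hlim
  rw [this, tsum_mul_left, theta]
  field_simp

/-! ### Symmetries of theta, lattice splittings and the Weierstrass relation -/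

theorem theta_mul_base {z p : ℂ} (hz : z ≠ 0) (hp : p ≠ 0) :
    theta (p * z) p = z⁻¹ * theta z p := by
  rw [theta, theta, ← (Equiv.addRight (1 : ℤ)).tsum_eq fun n => z ^ n * p ^ tri n, ← tsum_mul_left]
  refine tsum_congr fun n => ?_
  rw [Equiv.coe_addRight, tri_add_one, zpow_add₀ hz, zpow_add₀ hp, mul_zpow, zpow_one]
  field_simp

theorem theta_base_div {z p : ℂ} (hp : p ≠ 0) : theta (p / z) p = theta z p := by
  rw [theta, theta, ← (Equiv.neg ℤ).tsum_eq fun n => z ^ n * p ^ tri n]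
  refine tsum_congr fun n => ?_
  rw [Equiv.neg_apply, tri_neg, zpow_add₀ hp, div_zpow, zpow_neg]
  ring

/-- At z = -1 the quasi-period and the reflection express the value at -p with opposite signs. -/
theorem theta_neg_one {p : ℂ} (hp : p ≠ 0) : theta (-1) p = 0 := by
  have h1 := theta_mul_base (z := -1) (by norm_num) hp
  have h2 := theta_base_div (z := -1) hp
  rw [div_neg, div_one] at h2
  rw [mul_neg, mul_one, h2] at h1
  norm_num at h1
  linear_combination h1 / 2

theorem theta_mul_theta_eq_sum {a c p : ℂ} (ha : a ≠ 0) (hc : c ≠ 0) (hp : p ≠ 0) (hp1 : ‖p‖ < 1)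
    {k : ℕ} (e : Fin k × ℤ × ℤ ≃ ℤ × ℤ) :
    theta a p * theta c p = ∑ i : Fin k, ∑' x : ℤ × ℤ,
      a ^ (e (i, x)).1 * p ^ tri (e (i, x)).1 * (c ^ (e (i, x)).2 * p ^ tri (e (i, x)).2) := by
  have hs := summable_mul_of_summable_norm (summable_norm_theta ha hp hp1)
    (summable_norm_theta hc hp hp1)
  rw [theta, theta, tsum_mul_tsum_of_summable_norm (summable_norm_theta ha hp hp1)
    (summable_norm_theta hc hp hp1), ← e.tsum_eq]
  exact (Summable.tsum_prod (e.summable_iff.2 hs)).trans (tsum_fintype _)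

theorem tsum_eq_mul_theta_mul_theta {u v p r : ℂ} (hu : u ≠ 0) (hv : v ≠ 0) (hp : p ≠ 0)
    (hp1 : ‖p‖ < 1) {F : ℤ × ℤ → ℂ}
    (hF : ∀ s t, F (s, t) = r * (u ^ s * p ^ tri s * (v ^ t * p ^ tri t))) :
    ∑' x, F x = r * (theta u p * theta v p) := by
  rw [theta, theta, tsum_mul_tsum_of_summable_norm (summable_norm_theta hu hp hp1)
    (summable_norm_theta hv hp hp1), ← tsum_mul_left]
  exact tsum_congr fun x => hF x.1 x.2

/-- The coset decomposition of `ℤ²` modulo the sublattice spanned by `(1, 1)` and `(1, -1)`. -/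
noncomputable def latticeEquivTwo : Fin 2 × ℤ × ℤ ≃ ℤ × ℤ :=
  Equiv.ofBijective (fun x => (x.2.1 + x.2.2 + (x.1 : ℕ), x.2.1 - x.2.2)) <| by
    constructor
    · rintro ⟨i, k, l⟩ ⟨i', k', l'⟩ h
      simp only [Prod.mk.injEq] at h
      have := i.2
      have := i'.2
      have hi : (i : ℕ) = i' := by omega
      refine Prod.ext (Fin.ext hi) (Prod.ext ?_ ?_) <;> simp only <;> omega
    · rintro ⟨m, n⟩
      refine ⟨(⟨((m + n) % 2).toNat, by omega⟩, (m + n) / 2, (m + n) / 2 - n), ?_⟩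
      simp only [Prod.mk.injEq]
      omega

/-- The coset decomposition of `ℤ²` modulo the sublattice spanned by `(1, 2)` and `(2, -1)`. -/
noncomputable def latticeEquivFive : Fin 5 × ℤ × ℤ ≃ ℤ × ℤ :=
  Equiv.ofBijective (fun x => (x.2.1 + 2 * x.2.2, 2 * x.2.1 - x.2.2 + (x.1 : ℕ))) <| by
    constructor
    · rintro ⟨i, k, l⟩ ⟨i', k', l'⟩ h
      simp only [Prod.mk.injEq] at h
      have := i.2
      have := i'.2
      have hi : (i : ℕ) = i' := by omega
      refine Prod.ext (Fin.ext hi) (Prod.ext ?_ ?_) <;> simp only <;> omega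
    · rintro ⟨m, n⟩
      refine ⟨(⟨((n - 2 * m) % 5).toNat, by omega⟩, m + 2 * ((n - 2 * m) / 5),
        -((n - 2 * m) / 5)), ?_⟩
      simp only [Prod.mk.injEq]
      omega

theorem latticeEquivTwo_apply (i : Fin 2) (s t : ℤ) :
    latticeEquivTwo (i, s, t) = (s + t + (i : ℕ), s - t) := rfl

theorem latticeEquivFive_apply (i : Fin 5) (s t : ℤ) :
    latticeEquivFive (i, s, t) = (s + 2 * t, 2 * s - t + (i : ℕ)) := rfl

/-- The product of two theta series split over the cosets of an index-two sublattice of `ℤ²`. -/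
theorem theta_mul_theta_two {a c p : ℂ} (ha : a ≠ 0) (hc : c ≠ 0) (hp : p ≠ 0) (hp1 : ‖p‖ < 1) :
    theta a p * theta c p = theta (a * c) (p ^ 2) * theta (p * a / c) (p ^ 2) +
      a * (theta (p * a * c) (p ^ 2) * theta (p ^ 2 * a / c) (p ^ 2)) := by
  have hp2 : p ^ 2 ≠ 0 := pow_ne_zero _ hp
  have hp21 : ‖p ^ 2‖ < 1 := by simpa using pow_lt_one₀ (norm_nonneg p) hp1 two_ne_zero
  rw [theta_mul_theta_eq_sum ha hc hp hp1 latticeEquivTwo, Fin.sum_univ_two,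
    tsum_eq_mul_theta_mul_theta (u := a * c) (v := p * a / c) (p := p ^ 2) (r := 1)
      (by positivity) (by positivity) hp2 hp21,
    tsum_eq_mul_theta_mul_theta (u := p * a * c) (v := p ^ 2 * a / c) (p := p ^ 2) (r := a)
      (by positivity) (by positivity) hp2 hp21, one_mul]
  · intro s t
    have h : p ^ tri (s + t + 1) * p ^ tri (s - t) =
        (p ^ 2) ^ tri s * (p ^ 2) ^ tri t * p ^ s * (p ^ 2) ^ t := by
      rw [← zpow_natCast p 2, ← zpow_mul, ← zpow_mul, ← zpow_mul, ← zpow_add₀ hp, ← zpow_add₀ hp,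
        ← zpow_add₀ hp, ← zpow_add₀ hp]
      congr 1
      have h1 := two_mul_tri (s + t + 1)
      have h2 := two_mul_tri (s - t)
      have h3 := two_mul_tri s
      have h4 := two_mul_tri t
      push_cast
      linarith
    simp only [latticeEquivTwo_apply, Fin.val_one, Nat.cast_one, mul_zpow, div_zpow,
      zpow_add₀ ha, zpow_sub₀ hc, zpow_one]
    linear_combination a * a ^ s * a ^ t * (c ^ s / c ^ t) * h
  · intro s t
    have h : p ^ tri (s + t) * p ^ tri (s - t) = (p ^ 2) ^ tri s * (p ^ 2) ^ tri t * p ^ t := by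
      rw [← zpow_natCast p 2, ← zpow_mul, ← zpow_mul, ← zpow_add₀ hp, ← zpow_add₀ hp,
        ← zpow_add₀ hp]
      congr 1
      have h1 := two_mul_tri (s + t)
      have h2 := two_mul_tri (s - t)
      have h3 := two_mul_tri s
      have h4 := two_mul_tri t
      push_cast
      linarith
    simp only [latticeEquivTwo_apply, Fin.val_zero, Nat.cast_zero, add_zero, mul_zpow, div_zpow,
      zpow_add₀ ha, zpow_sub₀ hc]
    linear_combination a ^ s * a ^ t * (c ^ s / c ^ t) * h

/-- The product of two theta series split over the cosets of an index-five sublattice of `ℤ²`. -/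
theorem theta_mul_theta_five {a c p : ℂ} (ha : a ≠ 0) (hc : c ≠ 0) (hp : p ≠ 0) (hp1 : ‖p‖ < 1) :
    theta a p * theta c p = ∑ j : Fin 5, c ^ (j : ℤ) * p ^ tri (j : ℤ) *
      (theta (a * c ^ 2 * p ^ (1 + 2 * j : ℤ)) (p ^ 5) *
        theta (a ^ 2 * c⁻¹ * p ^ (2 - j : ℤ)) (p ^ 5)) := by
  have hp2 : p ^ 5 ≠ 0 := pow_ne_zero _ hp
  have hp21 : ‖p ^ 5‖ < 1 := by simpa using pow_lt_one₀ (norm_nonneg p) hp1 (by norm_num)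
  rw [theta_mul_theta_eq_sum ha hc hp hp1 latticeEquivFive]
  refine sum_congr rfl fun j _ => ?_
  refine tsum_eq_mul_theta_mul_theta (by positivity) (by positivity) hp2 hp21 ?_
  intro s t
  have h : p ^ tri (s + 2 * t) * p ^ tri (2 * s - t + j) =
      p ^ tri (j : ℤ) * (p ^ 5) ^ tri s * (p ^ 5) ^ tri t * (p ^ (1 + 2 * j : ℤ)) ^ s *
        (p ^ (2 - j : ℤ)) ^ t := by
    rw [← zpow_natCast p 5]
    simp only [← zpow_mul, ← zpow_add₀ hp]
    congr 1
    have h1 := two_mul_tri (s + 2 * t)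
    have h2 := two_mul_tri (2 * s - t + j)
    have h3 := two_mul_tri s
    have h4 := two_mul_tri t
    have h5 := two_mul_tri j
    push_cast
    linarith
  have hc' : c ^ (2 * s - t + j) = c ^ (j : ℤ) * (c ^ 2) ^ s * (c ^ t)⁻¹ := by
    rw [zpow_add₀ hc, zpow_sub₀ hc, zpow_mul, zpow_ofNat]
    ring
  have ha' : a ^ (s + 2 * t) = a ^ s * (a ^ 2) ^ t := by
    rw [zpow_add₀ ha, zpow_mul, zpow_ofNat]
  simp only [latticeEquivFive_apply, mul_zpow, inv_zpow]
  rw [ha', hc']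
  linear_combination a ^ s * (a ^ 2) ^ t * c ^ (j : ℤ) * (c ^ 2) ^ s * (c ^ t)⁻¹ * h

/-- With A(z) = θ(z²; p²) and B(z) = θ(pz²; p²), the right side is 1/y times the 2 × 2 determinant
of the vectors (A(x), xB(x)) and (A(y), yB(y)). -/
theorem theta_neg_mul_theta_neg {x y p : ℂ} (hx : x ≠ 0) (hy : y ≠ 0) (hp : p ≠ 0)
    (hp1 : ‖p‖ < 1) :
    theta (-(x * y)) p * theta (-(x / y)) p =
      theta (x ^ 2) (p ^ 2) * theta (p * y ^ 2) (p ^ 2) -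
        x / y * (theta (p * x ^ 2) (p ^ 2) * theta (y ^ 2) (p ^ 2)) := by
  rw [theta_mul_theta_two (neg_ne_zero.2 (mul_ne_zero hx hy)) (neg_ne_zero.2 (div_ne_zero hx hy))
    hp hp1, show -(x * y) * -(x / y) = x ^ 2 by field_simp,
    show p * -(x * y) / -(x / y) = p * y ^ 2 by field_simp,
    show p * -(x * y) * -(x / y) = p * x ^ 2 by field_simp,
    show p ^ 2 * -(x * y) / -(x / y) = p ^ 2 * y ^ 2 by field_simp,
    theta_mul_base (pow_ne_zero 2 hy) (pow_ne_zero 2 hp)]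
  field_simp
  ring

/-- The three-term relation of Weierstrass for theta functions. -/
theorem theta_weierstrass {x y u v p : ℂ} (hx : x ≠ 0) (hy : y ≠ 0) (hu : u ≠ 0) (hv : v ≠ 0)
    (hp : p ≠ 0) (hp1 : ‖p‖ < 1) :
    theta (-(x * y)) p * theta (-(x / y)) p * (theta (-(u * v)) p * theta (-(u / v)) p) -
        theta (-(x * v)) p * theta (-(x / v)) p * (theta (-(u * y)) p * theta (-(u / y)) p) =
      u / y * (theta (-(y * v)) p * theta (-(y / v)) p *
        (theta (-(x * u)) p * theta (-(x / u)) p)) := by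
  -- Every pair of factors becomes a 2 × 2 determinant, and the claim is the Plücker relation for
  -- four vectors in the plane.
  simp only [theta_neg_mul_theta_neg, *, ne_eq, not_false_eq_true]
  field_simp
  ring

/-! ### Theta series at signed powers of q -/

/-- The theta series `∑ εⁿ q ^ (k n + N n (n - 1) / 2)`. -/
noncomputable def qTheta (q ε : ℂ) (k : ℤ) (N : ℕ) : ℂ := theta (ε * q ^ k) (q ^ N)

theorem qTheta_shift {q : ℂ} (hq : q ≠ 0) {ε : ℂ} (hε : ε * ε = 1) (k : ℤ) (N : ℕ) :
    qTheta q ε (k + N) N = ε * q ^ (-k) * qTheta q ε k N := by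
  have h0 : ε ≠ 0 := left_ne_zero_of_mul_eq_one hε
  have h1 : ε⁻¹ = ε := inv_eq_of_mul_eq_one_left hε
  rw [qTheta, qTheta, zpow_add₀ hq, zpow_natCast,
    show ε * (q ^ k * q ^ N) = q ^ N * (ε * q ^ k) by ring,
    theta_mul_base (mul_ne_zero h0 (zpow_ne_zero k hq)) (pow_ne_zero N hq), mul_inv, h1, zpow_neg]

theorem qTheta_reflect {q : ℂ} (hq : q ≠ 0) {ε : ℂ} (hε : ε * ε = 1) (k : ℤ) (N : ℕ) :
    qTheta q ε (N - k) N = qTheta q ε k N := by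
  have h0 : ε ≠ 0 := left_ne_zero_of_mul_eq_one hε
  have h1 : ε⁻¹ = ε := inv_eq_of_mul_eq_one_left hε
  rw [qTheta, qTheta, ← theta_base_div (z := ε * q ^ k) (pow_ne_zero N hq), zpow_sub₀ hq,
    zpow_natCast, div_mul_eq_div_div,
    div_eq_mul_inv _ ε, h1]
  ring_nf

theorem qTheta_neg_one_zero {q : ℂ} (hq : q ≠ 0) (N : ℕ) : qTheta q (-1) 0 N = 0 := by
  simp [qTheta, theta_neg_one (pow_ne_zero N hq)]

theorem norm_pow_lt_one_of_ne_zero {q : ℂ} (hq1 : ‖q‖ < 1) {N : ℕ} (hN : N ≠ 0) : ‖q ^ N‖ < 1 := by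
  simpa using pow_lt_one₀ (norm_nonneg q) hq1 hN

theorem qTheta_mul_two {q : ℂ} (hq : q ≠ 0) (hq1 : ‖q‖ < 1) {ε δ : ℂ}
    (hε : ε * ε = 1) (hδ : δ * δ = 1) (a c : ℤ) {N : ℕ} (hN : N ≠ 0) :
    qTheta q ε a N * qTheta q δ c N =
      qTheta q (ε * δ) (a + c) (N * 2) * qTheta q (ε * δ) (N + a - c) (N * 2) +
      ε * q ^ a * (qTheta q (ε * δ) (N + a + c) (N * 2) *
        qTheta q (ε * δ) (N * 2 + a - c) (N * 2)) := by
  have h0 : ε ≠ 0 := left_ne_zero_of_mul_eq_one hε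
  have h1 : δ ≠ 0 := left_ne_zero_of_mul_eq_one hδ
  have h2 : δ⁻¹ = δ := inv_eq_of_mul_eq_one_left hδ
  simp only [qTheta]
  rw [theta_mul_theta_two (mul_ne_zero h0 (zpow_ne_zero a hq))
    (mul_ne_zero h1 (zpow_ne_zero c hq)) (pow_ne_zero N hq) (norm_pow_lt_one_of_ne_zero hq1 hN)]
  simp only [zpow_add₀ hq, zpow_sub₀ hq, zpow_natCast, ← pow_mul, div_eq_mul_inv, mul_inv, h2]
  have e : q ^ ((N : ℤ) * 2) = q ^ (N * 2) := by rw [← zpow_natCast]; push_cast; rfl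
  rw [e]
  ring_nf

theorem qTheta_mul_five {q : ℂ} (hq : q ≠ 0) (hq1 : ‖q‖ < 1) {ε δ : ℂ}
    (hε : ε * ε = 1) (hδ : δ * δ = 1) (a c : ℤ) {N : ℕ} (hN : N ≠ 0) :
    qTheta q ε a N * qTheta q δ c N = ∑ j : Fin 5, δ ^ (j : ℕ) * q ^ (c * j + N * tri j) *
      (qTheta q ε (a + 2 * c + N * (1 + 2 * j)) (N * 5) *
        qTheta q δ (2 * a - c + N * (2 - j)) (N * 5)) := by
  have h0 : ε ≠ 0 := left_ne_zero_of_mul_eq_one hε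
  have h1 : δ ≠ 0 := left_ne_zero_of_mul_eq_one hδ
  have h2 : δ⁻¹ = δ := inv_eq_of_mul_eq_one_left hδ
  simp only [qTheta]
  rw [theta_mul_theta_five (mul_ne_zero h0 (zpow_ne_zero a hq))
    (mul_ne_zero h1 (zpow_ne_zero c hq)) (pow_ne_zero N hq) (norm_pow_lt_one_of_ne_zero hq1 hN)]
  refine sum_congr rfl fun j _ => ?_
  have e1 : (δ * q ^ c) ^ (j : ℤ) * (q ^ N) ^ tri j = δ ^ (j : ℕ) * q ^ (c * j + N * tri j) := by
    rw [mul_zpow, zpow_natCast δ, zpow_add₀ hq, zpow_mul, zpow_mul, zpow_natCast q N]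
    ring
  have e2 : ε * q ^ a * (δ * q ^ c) ^ 2 * (q ^ N) ^ (1 + 2 * j : ℤ) =
      ε * q ^ (a + 2 * c + N * (1 + 2 * j)) := by
    rw [zpow_add₀ hq, zpow_add₀ hq, zpow_mul q N, zpow_natCast q N, mul_comm 2 c, zpow_mul q c 2,
      zpow_ofNat]
    linear_combination ε * q ^ a * (q ^ c) ^ 2 * (q ^ N) ^ (1 + 2 * j : ℤ) * hδ
  have e3 : (ε * q ^ a) ^ 2 * (δ * q ^ c)⁻¹ * (q ^ N) ^ (2 - j : ℤ) =
      δ * q ^ (2 * a - c + N * (2 - j)) := by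
    rw [zpow_add₀ hq, zpow_sub₀ hq, zpow_mul q N, zpow_natCast q N, mul_comm 2 a, zpow_mul q a 2,
      zpow_ofNat, mul_inv, h2]
    linear_combination (q ^ a) ^ 2 * δ / q ^ c * (q ^ N) ^ (2 - j : ℤ) * hε
  rw [e1, e2, e3, ← pow_mul]

theorem qTheta_eq_prod {q : ℂ} (hq : q ≠ 0) (hq1 : ‖q‖ < 1) {ε : ℂ}
    (hε : ε * ε = 1) (k : ℕ) {N : ℕ} (hN : N ≠ 0) (hk : k ≤ N) :
    qTheta q ε k N = qPoch (-ε * q ^ k) (q ^ N) * qPoch (-ε * q ^ (N - k)) (q ^ N) *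
      qPoch (q ^ N) (q ^ N) := by
  have h0 : ε ≠ 0 := left_ne_zero_of_mul_eq_one hε
  have h1 : ε⁻¹ = ε := inv_eq_of_mul_eq_one_left hε
  rw [qTheta, zpow_natCast, theta_eq_prod (mul_ne_zero h0 (pow_ne_zero k hq)) (pow_ne_zero N hq)
    (norm_pow_lt_one_of_ne_zero hq1 hN), pow_sub₀ q hq hk, div_mul_eq_div_div,
    div_eq_mul_inv _ ε, h1]
  ring_nf

/-! ### Identities between theta functions of bases 2, 5 and 10 -/

theorem qTheta_weierstrass_one {q : ℂ} (hq : q ≠ 0) (hq1 : ‖q‖ < 1) :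
    qTheta q 1 1 10 * qTheta q 1 3 10 ^ 2 * qTheta q 1 5 10 -
        qTheta q (-1) 1 10 * qTheta q (-1) 3 10 ^ 2 * qTheta q (-1) 5 10 =
      q * qTheta q 1 0 10 * qTheta q 1 2 10 ^ 2 * qTheta q 1 4 10 := by
  -- The opposite signs of `y` and `v` make the first product all positive and the second all
  -- negative in ε, with the same exponents 3, 1, 5, 3.
  have h := theta_weierstrass (x := -q ^ 2) (y := q) (u := q ^ 4) (v := -q) (p := q ^ 10)
    (by simpa) hq (by simpa) (by simpa) (by simpa) (norm_pow_lt_one_of_ne_zero hq1 (by norm_num))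
  have h6 : qTheta q 1 6 10 = qTheta q 1 4 10 := by
    simpa using qTheta_reflect hq (ε := 1) (by norm_num) 4 10
  have h8 : qTheta q 1 8 10 = qTheta q 1 2 10 := by
    simpa using qTheta_reflect hq (ε := 1) (by norm_num) 2 10
  have h2 : qTheta q 1 8 10 = q ^ 2 * qTheta q 1 (-2) 10 := by
    have := qTheta_shift hq (ε := 1) (by norm_num) (-2) 10
    norm_num at this
    exact_mod_cast this
  rw [h8] at h2
  rw [← h6, pow_two (qTheta q 1 2 10)]
  nth_rewrite 2 [h2]
  simp only [qTheta]
  rw [show -(-q ^ 2 * q) = 1 * q ^ (3 : ℤ) by simp only [zpow_ofNat]; ring,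
    show -(-q ^ 2 / q) = 1 * q ^ (1 : ℤ) by simp only [zpow_ofNat]; field_simp,
    show -(q ^ 4 * -q) = 1 * q ^ (5 : ℤ) by simp only [zpow_ofNat]; ring,
    show -(q ^ 4 / -q) = 1 * q ^ (3 : ℤ) by simp only [zpow_ofNat]; field_simp,
    show -(-q ^ 2 * -q) = -1 * q ^ (3 : ℤ) by simp only [zpow_ofNat]; ring,
    show -(-q ^ 2 / -q) = -1 * q ^ (1 : ℤ) by simp only [zpow_ofNat]; field_simp,
    show -(q ^ 4 * q) = -1 * q ^ (5 : ℤ) by simp only [zpow_ofNat]; ring,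
    show -(q ^ 4 / q) = -1 * q ^ (3 : ℤ) by simp only [zpow_ofNat]; field_simp,
    show -(q * -q) = 1 * q ^ (2 : ℤ) by simp only [zpow_ofNat]; ring,
    show -(q / -q) = 1 * q ^ (0 : ℤ) by norm_num; field_simp,
    show -(-q ^ 2 * q ^ 4) = 1 * q ^ (6 : ℤ) by simp only [zpow_ofNat]; ring,
    show -(-q ^ 2 / q ^ 4) = 1 * q ^ (-2 : ℤ) by rw [zpow_neg, zpow_ofNat]; field_simp,
    show q ^ 4 / q = q ^ 3 by field_simp] at h
  linear_combination h

theorem qTheta_weierstrass_three {q : ℂ} (hq : q ≠ 0) (hq1 : ‖q‖ < 1) :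
    qTheta q 1 1 10 ^ 2 * qTheta q 1 3 10 * qTheta q 1 5 10 +
        qTheta q (-1) 1 10 ^ 2 * qTheta q (-1) 3 10 * qTheta q (-1) 5 10 =
      qTheta q 1 0 10 * qTheta q 1 2 10 * qTheta q 1 4 10 ^ 2 := by
  -- These are the parameters of `qTheta_weierstrass_one` with q replaced by q³ but the base q¹⁰
  -- kept. Reducing exponent 15 to 5 costs a factor ε, which changes the minus sign into a plus.
  have h := theta_weierstrass (x := -q ^ 6) (y := q ^ 3) (u := q ^ 12) (v := -q ^ 3) (p := q ^ 10)
    (by simpa) (by simpa) (by simpa) (by simpa) (by simpa)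
    (norm_pow_lt_one_of_ne_zero hq1 (by norm_num))
  have h6 : qTheta q 1 6 10 = qTheta q 1 4 10 := by
    simpa using qTheta_reflect hq (ε := 1) (by norm_num) 4 10
  have h8 : qTheta q 1 8 10 = qTheta q 1 2 10 := by
    simpa using qTheta_reflect hq (ε := 1) (by norm_num) 2 10
  have h9 : qTheta q 1 9 10 = qTheta q 1 1 10 := by
    simpa using qTheta_reflect hq (ε := 1) (by norm_num) 1 10
  have h9' : qTheta q (-1) 9 10 = qTheta q (-1) 1 10 := by
    simpa using qTheta_reflect hq (ε := -1) (by norm_num) 1 10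
  have h15 : qTheta q 1 15 10 = q ^ (-5 : ℤ) * qTheta q 1 5 10 := by
    simpa using qTheta_shift hq (ε := 1) (by norm_num) 5 10
  have h15' : qTheta q (-1) 15 10 = -q ^ (-5 : ℤ) * qTheta q (-1) 5 10 := by
    simpa using qTheta_shift hq (ε := -1) (by norm_num) 5 10
  have h18 : qTheta q 1 18 10 = q ^ (-8 : ℤ) * qTheta q 1 8 10 := by
    simpa using qTheta_shift hq (ε := 1) (by norm_num) 8 10
  have h4 : qTheta q 1 4 10 = q ^ (6 : ℤ) * qTheta q 1 (-6) 10 := by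
    simpa using qTheta_shift hq (ε := 1) (by norm_num) (-6) 10
  rw [show -(-q ^ 6 * q ^ 3) = 1 * q ^ (9 : ℤ) by simp only [zpow_ofNat]; ring,
    show -(-q ^ 6 / q ^ 3) = 1 * q ^ (3 : ℤ) by simp only [zpow_ofNat]; field_simp,
    show -(q ^ 12 * -q ^ 3) = 1 * q ^ (15 : ℤ) by simp only [zpow_ofNat]; ring,
    show -(q ^ 12 / -q ^ 3) = 1 * q ^ (9 : ℤ) by simp only [zpow_ofNat]; field_simp,
    show -(-q ^ 6 * -q ^ 3) = -1 * q ^ (9 : ℤ) by simp only [zpow_ofNat]; ring,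
    show -(-q ^ 6 / -q ^ 3) = -1 * q ^ (3 : ℤ) by simp only [zpow_ofNat]; field_simp,
    show -(q ^ 12 * q ^ 3) = -1 * q ^ (15 : ℤ) by simp only [zpow_ofNat]; ring,
    show -(q ^ 12 / q ^ 3) = -1 * q ^ (9 : ℤ) by simp only [zpow_ofNat]; field_simp,
    show -(q ^ 3 * -q ^ 3) = 1 * q ^ (6 : ℤ) by simp only [zpow_ofNat]; ring,
    show -(q ^ 3 / -q ^ 3) = 1 * q ^ (0 : ℤ) by norm_num; field_simp,
    show -(-q ^ 6 * q ^ 12) = 1 * q ^ (18 : ℤ) by simp only [zpow_ofNat]; ring,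
    show -(-q ^ 6 / q ^ 12) = 1 * q ^ (-6 : ℤ) by rw [zpow_neg, zpow_ofNat]; field_simp,
    show q ^ 12 / q ^ 3 = q ^ 9 by field_simp] at h
  change qTheta q 1 9 10 * qTheta q 1 3 10 * (qTheta q 1 15 10 * qTheta q 1 9 10) -
      qTheta q (-1) 9 10 * qTheta q (-1) 3 10 * (qTheta q (-1) 15 10 * qTheta q (-1) 9 10) =
      q ^ 9 * (qTheta q 1 6 10 * qTheta q 1 0 10 * (qTheta q 1 18 10 * qTheta q 1 (-6) 10)) at h
  have h4' : qTheta q 1 (-6) 10 = q ^ (-6 : ℤ) * qTheta q 1 4 10 := by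
    rw [h4, ← mul_assoc, ← zpow_add₀ hq]; simp
  rw [h9, h9', h15, h15', h18, h6, h8, h4'] at h
  simp only [zpow_neg, zpow_ofNat] at h
  field_simp at h
  linear_combination h

theorem qTheta_neg_two_five_sq {q : ℂ} (hq : q ≠ 0) (hq1 : ‖q‖ < 1) :
    qTheta q (-1) 2 5 ^ 2 = qTheta q 1 4 10 * qTheta q 1 5 10 -
      q ^ 2 * (qTheta q 1 1 10 * qTheta q 1 0 10) := by
  have h := qTheta_mul_two hq hq1 (ε := -1) (δ := -1) (by norm_num) (by norm_num) 2 2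
    (N := 5) (by norm_num)
  have h9 : qTheta q 1 9 10 = qTheta q 1 1 10 := by
    simpa using qTheta_reflect hq (ε := 1) (by norm_num) 1 10
  have h10 : qTheta q 1 10 10 = qTheta q 1 0 10 := by
    simpa using qTheta_reflect hq (ε := 1) (by norm_num) 0 10
  norm_num [h9, h10] at h
  linear_combination h

theorem qTheta_neg_one_five_sq {q : ℂ} (hq : q ≠ 0) (hq1 : ‖q‖ < 1) :
    qTheta q (-1) 1 5 ^ 2 = qTheta q 1 2 10 * qTheta q 1 5 10 -
      q * (qTheta q 1 3 10 * qTheta q 1 0 10) := by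
  have h := qTheta_mul_two hq hq1 (ε := -1) (δ := -1) (by norm_num) (by norm_num) 1 1
    (N := 5) (by norm_num)
  have h9 : qTheta q 1 7 10 = qTheta q 1 3 10 := by
    simpa using qTheta_reflect hq (ε := 1) (by norm_num) 3 10
  have h10 : qTheta q 1 10 10 = qTheta q 1 0 10 := by
    simpa using qTheta_reflect hq (ε := 1) (by norm_num) 0 10
  norm_num [h9, h10] at h
  linear_combination h

theorem qTheta_one_five_sq {q : ℂ} (hq : q ≠ 0) (hq1 : ‖q‖ < 1) :
    qTheta q 1 1 5 ^ 2 = qTheta q 1 2 10 * qTheta q 1 5 10 +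
      q * (qTheta q 1 3 10 * qTheta q 1 0 10) := by
  have h := qTheta_mul_two hq hq1 (ε := 1) (δ := 1) (by norm_num) (by norm_num) 1 1
    (N := 5) (by norm_num)
  have h9 : qTheta q 1 7 10 = qTheta q 1 3 10 := by
    simpa using qTheta_reflect hq (ε := 1) (by norm_num) 3 10
  have h10 : qTheta q 1 10 10 = qTheta q 1 0 10 := by
    simpa using qTheta_reflect hq (ε := 1) (by norm_num) 0 10
  norm_num [h9, h10] at h
  linear_combination h

theorem qTheta_neg_one_five_mul_neg_two_five {q : ℂ} (hq : q ≠ 0) (hq1 : ‖q‖ < 1) :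
    qTheta q (-1) 1 5 * qTheta q (-1) 2 5 = qTheta q 1 3 10 * qTheta q 1 4 10 -
      q * (qTheta q 1 2 10 * qTheta q 1 1 10) := by
  have h := qTheta_mul_two hq hq1 (ε := -1) (δ := -1) (by norm_num) (by norm_num) 1 2
    (N := 5) (by norm_num)
  have h9 : qTheta q 1 9 10 = qTheta q 1 1 10 := by
    simpa using qTheta_reflect hq (ε := 1) (by norm_num) 1 10
  have h8 : qTheta q 1 8 10 = qTheta q 1 2 10 := by
    simpa using qTheta_reflect hq (ε := 1) (by norm_num) 2 10
  norm_num [h9, h8] at h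
  linear_combination h

theorem qPoch_base_two_eq (ε : ℂ) {q : ℂ} (hq1 : ‖q‖ < 1) (k : ℕ) :
    qPoch (ε * q ^ k) (q ^ 2) = qPoch (ε * q ^ k) (q ^ 10) * qPoch (ε * q ^ (k + 2)) (q ^ 10) *
      qPoch (ε * q ^ (k + 4)) (q ^ 10) * qPoch (ε * q ^ (k + 6)) (q ^ 10) *
      qPoch (ε * q ^ (k + 8)) (q ^ 10) := by
  rw [qPoch_eq_prod_qPoch_pow _ (norm_pow_lt_one_of_ne_zero hq1 two_ne_zero)
    (show 5 ≠ 0 by norm_num)]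
  simp only [prod_range_succ, prod_range_zero, one_mul]
  ring_nf

theorem qPoch_base_five_eq (ε : ℂ) {q : ℂ} (hq1 : ‖q‖ < 1) (k : ℕ) :
    qPoch (ε * q ^ k) (q ^ 5) =
      qPoch (ε * q ^ k) (q ^ 10) * qPoch (ε * q ^ (k + 5)) (q ^ 10) := by
  rw [qPoch_eq_prod_qPoch_pow _ (norm_pow_lt_one_of_ne_zero hq1 (by norm_num))
    (show 2 ≠ 0 by norm_num)]
  simp only [prod_range_succ, prod_range_zero, one_mul]
  ring_nf

/-- Each pair ±a merges into a² over base q²⁰, and the two resulting products interleave to base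
q¹⁰. -/
theorem qPoch_mul_four {q : ℂ} (hq1 : ‖q‖ < 1) (k : ℕ) :
    qPoch (q ^ k) (q ^ 10) * qPoch (-q ^ k) (q ^ 10) *
      (qPoch (q ^ (k + 5)) (q ^ 10) * qPoch (-q ^ (k + 5)) (q ^ 10)) =
      qPoch (q ^ (2 * k)) (q ^ 10) := by
  have h := norm_pow_lt_one_of_ne_zero hq1 (show 10 ≠ 0 by norm_num)
  rw [qPoch_mul_neg _ h, qPoch_mul_neg _ h, qPoch_eq_prod_qPoch_pow (q ^ (2 * k)) h two_ne_zero]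
  simp only [prod_range_succ, prod_range_zero, one_mul]
  ring_nf

theorem qTheta_one_eq {q : ℂ} (hq : q ≠ 0) (hq1 : ‖q‖ < 1) (k : ℕ) {N : ℕ} (hN : N ≠ 0)
    (hk : k ≤ N) :
    qTheta q 1 k N = qPoch (-q ^ k) (q ^ N) * qPoch (-q ^ (N - k)) (q ^ N) *
      qPoch (q ^ N) (q ^ N) := by
  simpa using qTheta_eq_prod hq hq1 (ε := 1) (by norm_num) k hN hk

theorem qTheta_neg_one_eq {q : ℂ} (hq : q ≠ 0) (hq1 : ‖q‖ < 1) (k : ℕ) {N : ℕ} (hN : N ≠ 0)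
    (hk : k ≤ N) :
    qTheta q (-1) k N = qPoch (q ^ k) (q ^ N) * qPoch (q ^ (N - k)) (q ^ N) *
      qPoch (q ^ N) (q ^ N) := by
  simpa using qTheta_eq_prod hq hq1 (ε := -1) (by norm_num) k hN hk

theorem qTheta_zero_two_eq {q : ℂ} (hq : q ≠ 0) (hq1 : ‖q‖ < 1) :
    qPoch (q ^ 10) (q ^ 10) ^ 4 * qTheta q 1 0 2 =
      qPoch (q ^ 2) (q ^ 10) * qPoch (q ^ 4) (q ^ 10) * qPoch (q ^ 6) (q ^ 10) *
        qPoch (q ^ 8) (q ^ 10) *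
        (qTheta q 1 0 10 * qTheta q 1 2 10 ^ 2 * qTheta q 1 4 10 ^ 2) := by
  have h2 := norm_pow_lt_one_of_ne_zero hq1 (show 2 ≠ 0 by norm_num)
  have h10 := norm_pow_lt_one_of_ne_zero hq1 (show 10 ≠ 0 by norm_num)
  have e1 := qTheta_one_eq hq hq1 0 (show 2 ≠ 0 by norm_num) (by norm_num)
  have e2 := qTheta_one_eq hq hq1 0 (show 10 ≠ 0 by norm_num) (by norm_num)
  have e3 := qTheta_one_eq hq hq1 2 (show 10 ≠ 0 by norm_num) (by norm_num)
  have e4 := qTheta_one_eq hq hq1 4 (show 10 ≠ 0 by norm_num) (by norm_num)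
  have f1 := qPoch_base_two_eq (-1) hq1 2
  have f2 := qPoch_base_two_eq 1 hq1 2
  have g1 := qPoch_eq_one_sub_mul (-1) h2
  have g2 := qPoch_eq_one_sub_mul (-1) h10
  norm_num at e1 e2 e3 e4 f1 f2 g1 g2
  rw [e1, e2, e3, e4, g1, g2, f1, f2]
  ring

theorem qTheta_one_two_eq {q : ℂ} (hq : q ≠ 0) (hq1 : ‖q‖ < 1) :
    qPoch (q ^ 10) (q ^ 10) ^ 4 * qTheta q 1 1 2 =
      qPoch (q ^ 2) (q ^ 10) * qPoch (q ^ 4) (q ^ 10) * qPoch (q ^ 6) (q ^ 10) *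
        qPoch (q ^ 8) (q ^ 10) *
        (qTheta q 1 1 10 ^ 2 * qTheta q 1 3 10 ^ 2 * qTheta q 1 5 10) := by
  have e1 := qTheta_one_eq hq hq1 1 (show 2 ≠ 0 by norm_num) (by norm_num)
  have e2 := qTheta_one_eq hq hq1 1 (show 10 ≠ 0 by norm_num) (by norm_num)
  have e3 := qTheta_one_eq hq hq1 3 (show 10 ≠ 0 by norm_num) (by norm_num)
  have e4 := qTheta_one_eq hq hq1 5 (show 10 ≠ 0 by norm_num) (by norm_num)
  have f1 := qPoch_base_two_eq (-1) hq1 1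
  have f2 := qPoch_base_two_eq 1 hq1 2
  norm_num at e1 e2 e3 e4 f1 f2
  rw [e1, e2, e3, e4, f1, f2]
  ring

theorem qTheta_neg_two_five_sq_eq_prod {q : ℂ} (hq : q ≠ 0) (hq1 : ‖q‖ < 1) :
    qPoch (q ^ 10) (q ^ 10) ^ 4 * qTheta q (-1) 2 5 ^ 2 =
      qPoch (q ^ 2) (q ^ 10) * qPoch (q ^ 4) (q ^ 10) * qPoch (q ^ 6) (q ^ 10) *
        qPoch (q ^ 8) (q ^ 10) *
        (qTheta q (-1) 1 10 * qTheta q (-1) 3 10 ^ 2 * qTheta q (-1) 5 10 *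
          (qTheta q 1 1 10 * qTheta q 1 4 10)) := by
  have e1 := qTheta_neg_one_eq hq hq1 2 (show 5 ≠ 0 by norm_num) (by norm_num)
  have e2 := qTheta_neg_one_eq hq hq1 1 (show 10 ≠ 0 by norm_num) (by norm_num)
  have e3 := qTheta_neg_one_eq hq hq1 3 (show 10 ≠ 0 by norm_num) (by norm_num)
  have e4 := qTheta_neg_one_eq hq hq1 5 (show 10 ≠ 0 by norm_num) (by norm_num)
  have e5 := qTheta_one_eq hq hq1 1 (show 10 ≠ 0 by norm_num) (by norm_num)
  have e6 := qTheta_one_eq hq hq1 4 (show 10 ≠ 0 by norm_num) (by norm_num)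
  have f1 := qPoch_base_five_eq 1 hq1 2
  have f2 := qPoch_base_five_eq 1 hq1 3
  have f3 := qPoch_base_five_eq 1 hq1 5
  have g1 := qPoch_mul_four hq1 1
  have g2 := qPoch_mul_four hq1 4
  norm_num at e1 e2 e3 e4 e5 e6 f1 f2 f3 g1 g2
  rw [e1, e2, e3, e4, e5, e6, f1, f2, f3]
  linear_combination -(qPoch (q ^ 10) (q ^ 10)) ^ 6 * qPoch (q ^ 2) (q ^ 10) *
    qPoch (q ^ 8) (q ^ 10) * (qPoch (q ^ 3) (q ^ 10) * qPoch (q ^ 7) (q ^ 10) *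
    qPoch (q ^ 5) (q ^ 10)) ^ 2 * (g1 * qPoch (q ^ 8) (q ^ 10) + g2 * (qPoch q (q ^ 10) *
    qPoch (-q) (q ^ 10) * (qPoch (q ^ 6) (q ^ 10) * qPoch (-q ^ 6) (q ^ 10))))

theorem qTheta_neg_one_five_sq_eq_prod {q : ℂ} (hq : q ≠ 0) (hq1 : ‖q‖ < 1) :
    qPoch (q ^ 10) (q ^ 10) ^ 4 * qTheta q (-1) 1 5 ^ 2 =
      qPoch (q ^ 2) (q ^ 10) * qPoch (q ^ 4) (q ^ 10) * qPoch (q ^ 6) (q ^ 10) *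
        qPoch (q ^ 8) (q ^ 10) *
        (qTheta q (-1) 1 10 ^ 2 * qTheta q (-1) 3 10 * qTheta q (-1) 5 10 *
          (qTheta q 1 2 10 * qTheta q 1 3 10)) := by
  have e1 := qTheta_neg_one_eq hq hq1 1 (show 5 ≠ 0 by norm_num) (by norm_num)
  have e2 := qTheta_neg_one_eq hq hq1 1 (show 10 ≠ 0 by norm_num) (by norm_num)
  have e3 := qTheta_neg_one_eq hq hq1 3 (show 10 ≠ 0 by norm_num) (by norm_num)
  have e4 := qTheta_neg_one_eq hq hq1 5 (show 10 ≠ 0 by norm_num) (by norm_num)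
  have e5 := qTheta_one_eq hq hq1 2 (show 10 ≠ 0 by norm_num) (by norm_num)
  have e6 := qTheta_one_eq hq hq1 3 (show 10 ≠ 0 by norm_num) (by norm_num)
  have f1 := qPoch_base_five_eq 1 hq1 1
  have f2 := qPoch_base_five_eq 1 hq1 4
  have f3 := qPoch_base_five_eq 1 hq1 5
  have g1 := qPoch_mul_four hq1 3
  have g2 := qPoch_mul_four hq1 2
  norm_num at e1 e2 e3 e4 e5 e6 f1 f2 f3 g1 g2
  rw [e1, e2, e3, e4, e5, e6, f1, f2, f3]
  linear_combination -(qPoch (q ^ 10) (q ^ 10)) ^ 6 * qPoch (q ^ 4) (q ^ 10) *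
    qPoch (q ^ 6) (q ^ 10) * (qPoch q (q ^ 10) * qPoch (q ^ 9) (q ^ 10) *
    qPoch (q ^ 5) (q ^ 10)) ^ 2 * (g1 * qPoch (q ^ 4) (q ^ 10) + g2 * (qPoch (q ^ 3) (q ^ 10) *
    qPoch (-q ^ 3) (q ^ 10) * (qPoch (q ^ 8) (q ^ 10) * qPoch (-q ^ 8) (q ^ 10))))

theorem qPoch_pow_ne_zero {q : ℂ} (hq1 : ‖q‖ < 1) {k N : ℕ} (hk : k ≠ 0) (hN : N ≠ 0) :
    qPoch (q ^ k) (q ^ N) ≠ 0 :=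
  qPoch_ne_zero (norm_pow_lt_one_of_ne_zero hq1 hN) (norm_pow_lt_one_of_ne_zero hq1 hk)

/-- `φ(q) f(q⁴, q⁶) - 2 q ψ(q²) f(q, q⁹) = f(-q², -q³)²`, for the theta functions of Ramanujan. -/
theorem phi_mul_sub_psi_mul {q : ℂ} (hq : q ≠ 0) (hq1 : ‖q‖ < 1) :
    qTheta q 1 1 2 * qTheta q 1 4 10 - q * (qTheta q 1 0 2 * qTheta q 1 1 10) =
      qTheta q (-1) 2 5 ^ 2 := by
  have h0 := pow_ne_zero 4 (qPoch_pow_ne_zero hq1 (k := 10) (N := 10) (by norm_num) (by norm_num))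
  refine mul_left_cancel₀ h0 ?_
  rw [qTheta_neg_two_five_sq_eq_prod hq hq1]
  have h1 := qTheta_zero_two_eq hq hq1
  have h2 := qTheta_one_two_eq hq hq1
  have h3 := qTheta_weierstrass_one hq hq1
  linear_combination qTheta q 1 4 10 * h2 - q * qTheta q 1 1 10 * h1 +
    qPoch (q ^ 2) (q ^ 10) * qPoch (q ^ 4) (q ^ 10) * qPoch (q ^ 6) (q ^ 10) *
        qPoch (q ^ 8) (q ^ 10) * (qTheta q 1 1 10 * qTheta q 1 4 10) * h3

/-- `2 ψ(q²) f(q³, q⁷) - φ(q) f(q², q⁸) = f(-q, -q⁴)²`, for the theta functions of Ramanujan. -/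
theorem psi_mul_sub_phi_mul {q : ℂ} (hq : q ≠ 0) (hq1 : ‖q‖ < 1) :
    qTheta q 1 0 2 * qTheta q 1 3 10 - qTheta q 1 1 2 * qTheta q 1 2 10 =
      qTheta q (-1) 1 5 ^ 2 := by
  have h0 := pow_ne_zero 4 (qPoch_pow_ne_zero hq1 (k := 10) (N := 10) (by norm_num) (by norm_num))
  refine mul_left_cancel₀ h0 ?_
  rw [qTheta_neg_one_five_sq_eq_prod hq hq1]
  have h1 := qTheta_zero_two_eq hq hq1
  have h2 := qTheta_one_two_eq hq hq1
  have h3 := qTheta_weierstrass_three hq hq1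
  linear_combination qTheta q 1 3 10 * h1 - qTheta q 1 2 10 * h2 -
    qPoch (q ^ 2) (q ^ 10) * qPoch (q ^ 4) (q ^ 10) * qPoch (q ^ 6) (q ^ 10) *
        qPoch (q ^ 8) (q ^ 10) * (qTheta q 1 2 10 * qTheta q 1 3 10) * h3

/-- `ψ(q²) φ(q⁵) - q φ(q) ψ(q¹⁰) = f(-q, -q⁴) f(-q², -q³)`, for the theta functions of Ramanujan. -/
theorem psi_mul_phi_sub {q : ℂ} (hq : q ≠ 0) (hq1 : ‖q‖ < 1) :
    qTheta q 1 0 2 * qTheta q 1 5 10 - q * (qTheta q 1 1 2 * qTheta q 1 0 10) =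
      2 * (qTheta q (-1) 1 5 * qTheta q (-1) 2 5) := by
  have hX : qTheta q (-1) 2 5 ≠ 0 := by
    have := qTheta_neg_one_eq hq hq1 2 (show 5 ≠ 0 by norm_num) (by norm_num)
    norm_num at this
    rw [this]
    refine mul_ne_zero (mul_ne_zero ?_ ?_) ?_ <;>
      exact qPoch_pow_ne_zero hq1 (by norm_num) (by norm_num)
  have hY : qTheta q (-1) 1 5 ≠ 0 := by
    have := qTheta_neg_one_eq hq hq1 1 (show 5 ≠ 0 by norm_num) (by norm_num)
    rw [Nat.cast_one] at this
    rw [this]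
    refine mul_ne_zero (mul_ne_zero ?_ ?_) ?_ <;>
      exact qPoch_pow_ne_zero hq1 (by norm_num) (by norm_num)
  have h1 := phi_mul_sub_psi_mul hq hq1
  have h2 := psi_mul_sub_phi_mul hq hq1
  have h3 := qTheta_neg_two_five_sq hq hq1
  have h4 := qTheta_neg_one_five_sq hq hq1
  have h5 := qTheta_neg_one_five_mul_neg_two_five hq hq1
  -- The available relations determine only X², Y² and XY, so the claim is proved after
  -- multiplication by XY.
  refine mul_left_cancel₀ (mul_ne_zero hY hX) ?_
  generalize qTheta q (-1) 1 5 = Y at *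
  generalize qTheta q (-1) 2 5 = X at *
  generalize qTheta q 1 0 2 = c at *
  generalize qTheta q 1 1 2 = a at *
  generalize qTheta q 1 0 10 = d at *
  generalize qTheta q 1 5 10 = b at *
  generalize qTheta q 1 1 10 = s at *
  generalize qTheta q 1 2 10 = m at *
  generalize qTheta q 1 3 10 = t at *
  generalize qTheta q 1 4 10 = n at *
  -- X² and Y² each have two expressions. Pairing them crosswise gives X²Y² twice, and in the sum
  -- the terms `a * n * m * b` and `q ^ 2 * c * s * t * d` cancel, leaving this factorisation.
  have key : (t * n - q * (m * s)) * (c * b - q * (a * d)) = 2 * (X ^ 2 * Y ^ 2) := by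
    have e1 : X ^ 2 * Y ^ 2 = (a * n - q * (c * s)) * (m * b - q * (t * d)) := by rw [h1, h4]
    have e2 : X ^ 2 * Y ^ 2 = (n * b - q ^ 2 * (s * d)) * (c * t - a * m) := by rw [h2, h3]
    linear_combination -e1 - e2
  linear_combination (c * b - q * (a * d)) * h5 + key

/-! ### The five-dissection -/

theorem qTheta_five_mul (q ε : ℂ) (k : ℤ) (N : ℕ) :
    qTheta q ε (5 * k) (5 * N) = qTheta (q ^ 5) ε k N := by
  rw [qTheta, qTheta, zpow_mul, pow_mul, zpow_ofNat]

theorem qTheta_neg {q : ℂ} (hq : q ≠ 0) {ε : ℂ} (hε : ε * ε = 1) (k : ℤ) (N : ℕ) :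
    qTheta q ε (-k) N = ε * q ^ (-k) * qTheta q ε k N := by
  have h1 := qTheta_shift hq hε (-k) N
  rw [neg_add_eq_sub, qTheta_reflect hq hε, neg_neg] at h1
  have h2 : q ^ (-k) * q ^ k = 1 := by rw [← zpow_add₀ hq]; simp
  rw [h1]
  linear_combination -qTheta q ε (-k) N * hε - ε * ε * qTheta q ε (-k) N * h2

theorem qTheta_two_mul_four {q : ℂ} (hq : q ≠ 0) (hq1 : ‖q‖ < 1) :
    qTheta q 1 2 10 * qTheta q (-1) 4 10 =
      qTheta q 1 20 50 * qTheta q (-1) 20 50 + q ^ 2 * (qTheta q 1 20 50 * qTheta q (-1) 10 50) -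
      q ^ 4 * (qTheta q 1 10 50 * qTheta q (-1) 10 50) -
      q ^ 6 * (qTheta q 1 0 50 * qTheta q (-1) 20 50) := by
  have h := qTheta_mul_five hq hq1 (ε := 1) (δ := -1) (by norm_num) (by norm_num) 2 4
    (N := 10) (by norm_num)
  rw [Fin.sum_univ_five] at h
  norm_num [tri] at h
  have h40 : qTheta q 1 40 50 = qTheta q 1 10 50 := by
    simpa using qTheta_reflect hq (ε := 1) (by norm_num) 10 50
  have h30 : qTheta q 1 30 50 = qTheta q 1 20 50 := by
    simpa using qTheta_reflect hq (ε := 1) (by norm_num) 20 50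
  have h50 : qTheta q 1 50 50 = qTheta q 1 0 50 := by
    simpa using qTheta_reflect hq (ε := 1) (by norm_num) 0 50
  have h80 : qTheta q 1 80 50 = q ^ (-30 : ℤ) * qTheta q 1 30 50 := by
    simpa using qTheta_shift hq (ε := 1) (by norm_num) 30 50
  have h100 : qTheta q 1 100 50 = q ^ (-50 : ℤ) * qTheta q 1 50 50 := by
    simpa using qTheta_shift hq (ε := 1) (by norm_num) 50 50
  have n10 := qTheta_neg hq (ε := -1) (by norm_num) 10 50
  have n20 := qTheta_neg hq (ε := -1) (by norm_num) 20 50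
  -- The coset j = 2, whose power of q has residue 3 modulo 5, contains the vanishing theta value.
  rw [h, h80, h100, n10, n20, h30, h40, h50, qTheta_neg_one_zero hq]
  simp only [zpow_neg, zpow_ofNat]
  field_simp
  ring

theorem qTheta_three_mul_four {q : ℂ} (hq : q ≠ 0) (hq1 : ‖q‖ < 1) :
    qTheta q 1 3 10 * qTheta q (-1) 4 10 =
      qTheta q 1 25 50 * qTheta q (-1) 20 50 + q ^ 3 * (qTheta q 1 15 50 * qTheta q (-1) 10 50) -
      q ^ 4 * (qTheta q 1 5 50 * qTheta q (-1) 20 50) -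
      q ^ 6 * (qTheta q 1 5 50 * qTheta q (-1) 10 50) := by
  -- Exponent 3 is first reflected to 7, because 7 + 2·4 and 2·7 - 4 are multiples of 5, so that the
  -- theta factors depend on q⁵ only. The vanishing coset is now j = 3, of residue 2, which the
  -- outer factor q later moves to residue 3.
  have h := qTheta_mul_five hq hq1 (ε := 1) (δ := -1) (by norm_num) (by norm_num) 7 4
    (N := 10) (by norm_num)
  rw [Fin.sum_univ_five] at h
  norm_num [tri] at h
  have h7 : qTheta q 1 7 10 = qTheta q 1 3 10 := by
    simpa using qTheta_reflect hq (ε := 1) (by norm_num) 3 10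
  have h30 : qTheta q (-1) 30 50 = qTheta q (-1) 20 50 := by
    simpa using qTheta_reflect hq (ε := -1) (by norm_num) 20 50
  have h45 : qTheta q 1 45 50 = qTheta q 1 5 50 := by
    simpa using qTheta_reflect hq (ε := 1) (by norm_num) 5 50
  have h65 : qTheta q 1 65 50 = q ^ (-15 : ℤ) * qTheta q 1 15 50 := by
    simpa using qTheta_shift hq (ε := 1) (by norm_num) 15 50
  have h105 : qTheta q 1 105 50 = q ^ (-55 : ℤ) * qTheta q 1 55 50 := by
    simpa using qTheta_shift hq (ε := 1) (by norm_num) 55 50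
  have h55 : qTheta q 1 55 50 = q ^ (-5 : ℤ) * qTheta q 1 5 50 := by
    simpa using qTheta_shift hq (ε := 1) (by norm_num) 5 50
  have n10 := qTheta_neg hq (ε := -1) (by norm_num) 10 50
  rw [← h7, h, h65, h105, h55, n10, h30, h45, qTheta_neg_one_zero hq]
  simp only [zpow_neg, zpow_ofNat]
  field_simp
  ring

theorem theta_five_dissection {q : ℂ} (hq : q ≠ 0) (hq1 : ‖q‖ < 1) :
    qTheta q 1 1 5 ^ 2 * qTheta q (-1) 4 10 =
      qTheta (q ^ 5) (-1) 2 5 ^ 2 * qTheta (q ^ 5) (-1) 4 10 +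
      q * (2 * (qTheta (q ^ 5) (-1) 1 5 * qTheta (q ^ 5) (-1) 2 5) *
        qTheta (q ^ 5) (-1) 4 10) +
      q ^ 2 * (qTheta (q ^ 5) (-1) 2 5 ^ 2 * qTheta (q ^ 5) (-1) 2 10) +
      q ^ 4 * (qTheta (q ^ 5) (-1) 1 5 ^ 2 * qTheta (q ^ 5) (-1) 2 10) := by
  have hQ : q ^ 5 ≠ 0 := pow_ne_zero 5 hq
  have hQ1 := norm_pow_lt_one_of_ne_zero hq1 (show 5 ≠ 0 by norm_num)
  have h2 := qTheta_two_mul_four hq hq1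
  have h3 := qTheta_three_mul_four hq hq1
  have e (ε : ℂ) (k : ℤ) : qTheta q ε (5 * k) 50 = qTheta (q ^ 5) ε k 10 :=
    qTheta_five_mul q ε k 10
  have f (ε : ℂ) (k : ℤ) : qTheta q ε (5 * k) 10 = qTheta (q ^ 5) ε k 2 :=
    qTheta_five_mul q ε k 2
  have e0 := e 1 0
  have e1 := e 1 1
  have e2 := e 1 2
  have e3 := e 1 3
  have e4 := e 1 4
  have e5 := e 1 5
  have e6 := e (-1) 2
  have e7 := e (-1) 4
  have f0 := f 1 0
  have f1 := f 1 1
  norm_num at e0 e1 e2 e3 e4 e5 e6 e7 f0 f1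
  rw [qTheta_one_five_sq hq hq1, ← phi_mul_sub_psi_mul hQ hQ1, ← psi_mul_sub_phi_mul hQ hQ1,
    ← psi_mul_phi_sub hQ hQ1, ← e0, ← e1, ← e2, ← e3, ← e4, ← e5, ← e6, ← e7, ← f0, ← f1]
  -- The eight terms pair off by residue modulo 5 into the left sides of the three base identities
  -- at q⁵.
  linear_combination qTheta q 1 5 10 * h2 + q * qTheta q 1 0 10 * h3

/-- The products that occur as components of `genG1` modulo `5`, indexed by the residue. -/
noncomputable def dissectionProduct : ℕ → ℂ → ℂ
  | 0, q => 1 / (qPochList [q, q ^ 4] (q ^ 5) ^ 2 * qPochList [q ^ 2, q ^ 8] (q ^ 10))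
  | 1, q => 2 / (qPochList [q, q ^ 2, q ^ 3, q ^ 4] (q ^ 5) * qPochList [q ^ 2, q ^ 8] (q ^ 10))
  | 2, q => 1 / (qPochList [q, q ^ 4] (q ^ 5) ^ 2 * qPochList [q ^ 4, q ^ 6] (q ^ 10))
  | 4, q => 1 / (qPochList [q ^ 2, q ^ 3] (q ^ 5) ^ 2 * qPochList [q ^ 4, q ^ 6] (q ^ 10))
  | _, _ => 0

theorem qPoch_zero_left (q : ℂ) : qPoch 0 q = 1 := by simp [qPoch]

theorem qPoch_self_eq {q : ℂ} (hq1 : ‖q‖ < 1) :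
    qPoch q q = qPoch q (q ^ 5) * qPoch (q ^ 2) (q ^ 5) * qPoch (q ^ 3) (q ^ 5) *
      qPoch (q ^ 4) (q ^ 5) * qPoch (q ^ 5) (q ^ 5) := by
  rw [qPoch_eq_prod_qPoch_pow _ hq1 (show 5 ≠ 0 by norm_num)]
  simp only [prod_range_succ, prod_range_zero, one_mul]
  ring_nf

theorem genG1_eq_dissection {q : ℂ} (hq1 : ‖q‖ < 1) :
    genG1 q = dissectionProduct 0 (q ^ 5) + q * dissectionProduct 1 (q ^ 5) +
      q ^ 2 * dissectionProduct 2 (q ^ 5) + q ^ 4 * dissectionProduct 4 (q ^ 5) := by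
  -- The theta series use negative powers of q, so the origin is checked directly.
  rcases eq_or_ne q 0 with rfl | hq
  · simp [genG1, dissectionProduct, qPochList, qPoch_zero_left]
  have hQ : q ^ 5 ≠ 0 := pow_ne_zero 5 hq
  have hQ1 := norm_pow_lt_one_of_ne_zero hq1 (show 5 ≠ 0 by norm_num)
  have h := theta_five_dissection hq hq1
  have t1 := qTheta_one_eq hq hq1 1 (show 5 ≠ 0 by norm_num) (by norm_num)
  have t2 := qTheta_neg_one_eq hq hq1 4 (show 10 ≠ 0 by norm_num) (by norm_num)
  have s1 := qTheta_neg_one_eq hQ hQ1 1 (show 5 ≠ 0 by norm_num) (by norm_num)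
  have s2 := qTheta_neg_one_eq hQ hQ1 2 (show 5 ≠ 0 by norm_num) (by norm_num)
  have s3 := qTheta_neg_one_eq hQ hQ1 2 (show 10 ≠ 0 by norm_num) (by norm_num)
  have s4 := qTheta_neg_one_eq hQ hQ1 4 (show 10 ≠ 0 by norm_num) (by norm_num)
  have u1 := qPoch_self_eq hQ1
  have u2 := qPoch_base_two_eq 1 hQ1 2
  have e : q ^ 10 = (q ^ 5) ^ 2 := by ring
  have nz {k N : ℕ} (hk : k ≠ 0) (hN : N ≠ 0) := qPoch_pow_ne_zero hQ1 hk hN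
  have n1 := nz (k := 1) (N := 5) (by norm_num) (by norm_num)
  have n2 := nz (k := 2) (N := 5) (by norm_num) (by norm_num)
  have n3 := nz (k := 3) (N := 5) (by norm_num) (by norm_num)
  have n4 := nz (k := 4) (N := 5) (by norm_num) (by norm_num)
  have n5 := nz (k := 5) (N := 5) (by norm_num) (by norm_num)
  have m2 := nz (k := 2) (N := 10) (by norm_num) (by norm_num)
  have m4 := nz (k := 4) (N := 10) (by norm_num) (by norm_num)
  have m6 := nz (k := 6) (N := 10) (by norm_num) (by norm_num)
  have m8 := nz (k := 8) (N := 10) (by norm_num) (by norm_num)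
  have m10 := nz (k := 10) (N := 10) (by norm_num) (by norm_num)
  simp only [Nat.cast_one, Nat.cast_ofNat, pow_one, one_mul, Nat.reduceSub, Nat.reduceAdd]
    at t1 t2 s1 s2 s3 s4 u2 n1
  rw [t1, t2, s1, s2, s3, s4, u1, e, u2] at h
  simp only [genG1, dissectionProduct, qPochList, List.map_cons, List.map_nil, List.prod_cons,
    List.prod_nil, mul_one]
  rw [e]
  generalize q ^ 5 = Q at *
  generalize qPoch Q (Q ^ 5) = x1 at *
  generalize qPoch (Q ^ 2) (Q ^ 5) = x2 at *
  generalize qPoch (Q ^ 3) (Q ^ 5) = x3 at *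
  generalize qPoch (Q ^ 4) (Q ^ 5) = x4 at *
  generalize qPoch (Q ^ 5) (Q ^ 5) = x5 at *
  generalize qPoch (Q ^ 2) (Q ^ 10) = y2 at *
  generalize qPoch (Q ^ 4) (Q ^ 10) = y4 at *
  generalize qPoch (Q ^ 6) (Q ^ 10) = y6 at *
  generalize qPoch (Q ^ 8) (Q ^ 10) = y8 at *
  generalize qPoch (Q ^ 10) (Q ^ 10) = y10 at *
  -- This is (Q;Q)²(Q²;Q²) with Q = q⁵, the factor separating the products from the theta functions.
  have hE : (x1 * x2 * x3 * x4 * x5) ^ 2 * (y2 * y4 * y6 * y8 * y10) ≠ 0 := by positivity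
  refine mul_left_cancel₀ hE ?_
  refine Eq.trans ?_ (h.trans ?_)
  · ring
  · field_simp

/-! ### Holomorphy and comparison of Taylor coefficients -/

theorem differentiableOn_qPochList {as : List (ℂ → ℂ)} (h : ∀ a ∈ as, Differentiable ℂ a)
    {k : ℕ} (hk : k ≠ 0) :
    DifferentiableOn ℂ (fun q => qPochList (as.map fun a => a q) (q ^ k))
      (Metric.ball (0 : ℂ) 1) := by
  induction as with
  | nil => simp [qPochList]
  | cons a as ih =>
    simpa [qPochList] using! (differentiableOn_qPoch (h a (by simp)) hk).mul
      (ih fun b hb => h b (by simp [hb]))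

theorem differentiableOn_genG1 : DifferentiableOn ℂ genG1 (Metric.ball (0 : ℂ) 1) := by
  have h1 := differentiableOn_qPochList (as := [fun q => -q, fun q => -q ^ 4])
    (by simp only [List.forall_mem_cons]; refine ⟨by fun_prop, by fun_prop, by simp⟩)
    (show 5 ≠ 0 by norm_num)
  have h2 := differentiableOn_qPochList (as := [fun q => q ^ 4, fun q => q ^ 6])
    (by simp only [List.forall_mem_cons]; refine ⟨by fun_prop, by fun_prop, by simp⟩)
    (show 10 ≠ 0 by norm_num)
  exact (h1.pow 2).mul h2

theorem qPochList_pow_ne_zero {q : ℂ} (hq1 : ‖q‖ < 1) (ks : List ℕ) (hks : 0 ∉ ks) {N : ℕ}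
    (hN : N ≠ 0) : qPochList (ks.map fun k => q ^ k) (q ^ N) ≠ 0 := by
  rw [qPochList, ne_eq, List.prod_eq_zero_iff]
  simp only [List.map_map, List.mem_map, Function.comp, not_exists, not_and]
  exact fun k hk => qPoch_pow_ne_zero hq1 (fun h0 => hks (h0 ▸ hk)) hN

theorem differentiableOn_qPochList_pow (ks : List ℕ) {N : ℕ} (hN : N ≠ 0) :
    DifferentiableOn ℂ (fun q => qPochList (ks.map fun k => q ^ k) (q ^ N))
      (Metric.ball (0 : ℂ) 1) := by
  have := differentiableOn_qPochList (as := ks.map fun k q => q ^ k) (by simp) hN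
  simpa [List.map_map, Function.comp_def] using this

theorem differentiableOn_dissectionProduct (r : ℕ) :
    DifferentiableOn ℂ (dissectionProduct r) (Metric.ball (0 : ℂ) 1) := by
  have key (c : ℂ) (ks ls : List ℕ) (hk : 0 ∉ ks) (hl : 0 ∉ ls) (n : ℕ) :
      DifferentiableOn ℂ (fun q => c / (qPochList (ks.map fun k => q ^ k) (q ^ 5) ^ n *
        qPochList (ls.map fun k => q ^ k) (q ^ 10))) (Metric.ball (0 : ℂ) 1) := by
    refine (differentiableOn_const c).div (((differentiableOn_qPochList_pow ks (by norm_num)).pow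
      n).mul (differentiableOn_qPochList_pow ls (by norm_num))) fun q hq => ?_
    have hq1 : ‖q‖ < 1 := by simpa using hq
    exact mul_ne_zero (pow_ne_zero _ (qPochList_pow_ne_zero hq1 ks hk (by norm_num)))
      (qPochList_pow_ne_zero hq1 ls hl (by norm_num))
  match r with
  | 0 =>
    exact (key 1 [1, 4] [2, 8] (by simp) (by simp) 2).congr
      fun q _ => by simp [dissectionProduct]
  | 1 =>
    exact (key 2 [1, 2, 3, 4] [2, 8] (by simp) (by simp) 1).congr
      fun q _ => by simp [dissectionProduct]
  | 2 =>
    exact (key 1 [1, 4] [4, 6] (by simp) (by simp) 2).congr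
      fun q _ => by simp [dissectionProduct]
  | 3 => exact differentiableOn_const 0
  | 4 =>
    exact (key 1 [2, 3] [4, 6] (by simp) (by simp) 2).congr
      fun q _ => by simp [dissectionProduct]
  | n + 5 => exact differentiableOn_const 0

theorem hasSum_iteratedDeriv_div_factorial {f : ℂ → ℂ}
    (hf : DifferentiableOn ℂ f (Metric.ball 0 1)) {q : ℂ} (hq1 : ‖q‖ < 1) :
    HasSum (fun n : ℕ => iteratedDeriv n f 0 / (n.factorial : ℂ) * q ^ n) (f q) := by
  have h := Complex.hasSum_taylorSeries_on_ball hf (z := q) (by simpa using hq1)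
  refine h.congr_fun fun n => ?_
  simp only [sub_zero, smul_eq_mul]
  ring

theorem eq_of_hasSum_pow {f : ℂ → ℂ} {c d : ℕ → ℂ}
    (hc : ∀ q : ℂ, ‖q‖ < 1 → HasSum (fun n => c n * q ^ n) (f q))
    (hd : ∀ q : ℂ, ‖q‖ < 1 → HasSum (fun n => d n * q ^ n) (f q)) : c = d := by
  have key {c : ℕ → ℂ} (hc : ∀ q : ℂ, ‖q‖ < 1 → HasSum (fun n => c n * q ^ n) (f q)) :
      HasFPowerSeriesAt f (FormalMultilinearSeries.ofScalars ℂ c) 0 := by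
    rw [hasFPowerSeriesAt_iff]
    filter_upwards [Metric.ball_mem_nhds (0 : ℂ) one_pos] with q hq
    simpa [mul_comm] using hc q (by simpa using hq)
  have h := (key hc).eq_formalMultilinearSeries (key hd)
  funext n
  simpa using congrArg (fun p => p.coeff n) h

/-- Each component series is extended by zero off its residue class; the finitely many extensions
then add up termwise. -/
theorem hasSum_of_residue_components {c : ℕ → ℕ → ℂ} {G : ℕ → ℂ} {q : ℂ} {k : ℕ} (hk : k ≠ 0)
    (h : ∀ r < k, HasSum (fun n => c r n * (q ^ k) ^ n) (G r)) :
    HasSum (fun n => c (n % k) (n / k) * q ^ n) (∑ r ∈ range k, q ^ r * G r) := by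
  have h1 : ∀ r ∈ range k, HasSum (fun n => if n % k = r then c (n % k) (n / k) * q ^ n else 0)
      (q ^ r * G r) := by
    intro r hr
    have hr' := mem_range.1 hr
    have hinj : Function.Injective fun n : ℕ => k * n + r := fun a b hab =>
      Nat.eq_of_mul_eq_mul_left (Nat.pos_of_ne_zero hk) (Nat.add_right_cancel hab)
    rw [← hinj.hasSum_iff]
    · refine ((h r hr').mul_left (q ^ r)).congr_fun fun n => ?_
      simp only [Function.comp, Nat.mul_add_mod, Nat.mod_eq_of_lt hr', if_true,
        Nat.mul_add_div (Nat.pos_of_ne_zero hk), Nat.div_eq_of_lt hr', add_zero]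
      ring
    · intro n hn
      refine if_neg fun hnr => hn ⟨n / k, ?_⟩
      simp only
      rw [← hnr]
      exact Nat.div_add_mod n k
  refine (hasSum_sum h1).congr_fun fun n => ?_
  rw [Finset.sum_ite_eq, if_pos (mem_range.2 (Nat.mod_lt n (Nat.pos_of_ne_zero hk)))]

theorem hasSum_g1 {q : ℂ} (hq1 : ‖q‖ < 1) : HasSum (fun n : ℕ => g1 n * q ^ n) (genG1 q) :=
  hasSum_iteratedDeriv_div_factorial differentiableOn_genG1 hq1

/-- Interleaving the Taylor series of the five components gives a second expansion of `genG1`, and a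
power series expansion in the disc is unique. The zero component at r = 3 fits the same pattern. -/
theorem g1_five_mul_add {r : ℕ} (hr : r < 5) (n : ℕ) :
    g1 (5 * n + r) = iteratedDeriv n (dissectionProduct r) 0 / (n.factorial : ℂ) := by
  have h := eq_of_hasSum_pow (fun q => hasSum_g1) (d := fun n =>
    iteratedDeriv (n / 5) (dissectionProduct (n % 5)) 0 / ((n / 5).factorial : ℂ)) fun q hq1 => by
      have := hasSum_of_residue_components (k := 5) (q := q)
        (c := fun r n => iteratedDeriv n (dissectionProduct r) 0 / (n.factorial : ℂ))
        (G := fun r => dissectionProduct r (q ^ 5)) (by norm_num) fun r _ =>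
          hasSum_iteratedDeriv_div_factorial (differentiableOn_dissectionProduct r)
            (norm_pow_lt_one_of_ne_zero hq1 (by norm_num))
      convert this using 1
      rw [genG1_eq_dissection hq1]
      simp only [sum_range_succ, sum_range_zero]
      simp [dissectionProduct]
  rw [h]
  simp only [Nat.mul_add_mod, Nat.mod_eq_of_lt hr, Nat.mul_add_div (show 5 > 0 by norm_num),
    Nat.div_eq_of_lt hr, add_zero]

theorem hasSum_g1_five_mul_add {r : ℕ} (hr : r < 5) {q : ℂ} (hq1 : ‖q‖ < 1) :
    HasSum (fun n : ℕ => g1 (5 * n + r) * q ^ n) (dissectionProduct r q) := by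
  simp only [g1_five_mul_add hr]
  exact hasSum_iteratedDeriv_div_factorial (differentiableOn_dissectionProduct r) hq1

theorem G1comp_eq {r : ℕ} (hr : r < 5) {q : ℂ} (hq1 : ‖q‖ < 1) :
    G1comp r q = dissectionProduct r q := (hasSum_g1_five_mul_add hr hq1).tsum_eq

theorem mainTheorem1 :
    (∀ q : ℂ, ‖q‖ < 1 →
      HasSum (fun n : ℕ => g1 n * q ^ n)
        (qPochList [-q, -q ^ 4] (q ^ 5) ^ 2 * qPochList [q ^ 4, q ^ 6] (q ^ 10)) ∧
      qPochList [-q, -q ^ 4] (q ^ 5) ^ 2 * qPochList [q ^ 4, q ^ 6] (q ^ 10) =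
        G1comp 0 (q ^ 5) + q * G1comp 1 (q ^ 5) + q ^ 2 * G1comp 2 (q ^ 5)
          + q ^ 4 * G1comp 4 (q ^ 5) ∧
      HasSum (fun n : ℕ => g1 (5 * n) * q ^ n)
        (1 / (qPochList [q, q ^ 4] (q ^ 5) ^ 2 * qPochList [q ^ 2, q ^ 8] (q ^ 10))) ∧
      HasSum (fun n : ℕ => g1 (5 * n + 1) * q ^ n)
        (2 / (qPochList [q, q ^ 2, q ^ 3, q ^ 4] (q ^ 5) *
          qPochList [q ^ 2, q ^ 8] (q ^ 10))) ∧
      HasSum (fun n : ℕ => g1 (5 * n + 2) * q ^ n)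
        (1 / (qPochList [q, q ^ 4] (q ^ 5) ^ 2 * qPochList [q ^ 4, q ^ 6] (q ^ 10))) ∧
      HasSum (fun n : ℕ => g1 (5 * n + 4) * q ^ n)
        (1 / (qPochList [q ^ 2, q ^ 3] (q ^ 5) ^ 2 * qPochList [q ^ 4, q ^ 6] (q ^ 10)))) ∧
    ∀ n : ℕ, g1 (5 * n + 3) = 0 := by
  refine ⟨fun q hq1 => ⟨hasSum_g1 hq1, ?_, hasSum_g1_five_mul_add (r := 0) (by norm_num) hq1,
    hasSum_g1_five_mul_add (by norm_num) hq1, hasSum_g1_five_mul_add (by norm_num) hq1,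
    hasSum_g1_five_mul_add (by norm_num) hq1⟩, fun n => ?_⟩
  · have hQ1 := norm_pow_lt_one_of_ne_zero hq1 (show 5 ≠ 0 by norm_num)
    rw [G1comp_eq (by norm_num) hQ1, G1comp_eq (by norm_num) hQ1, G1comp_eq (by norm_num) hQ1,
      G1comp_eq (by norm_num) hQ1]
    exact genG1_eq_dissection hq1
  · rw [g1_five_mul_add (by norm_num)]
    have : dissectionProduct 3 = fun _ => 0 := by funext q; rfl
    simp [this]
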